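/- Let $d\ge 1$, let $\mathbb T^d_N=(\mathbb Z/N\mathbb Z)^d$ be the discrete torus with graph distance $|x-y|$, let $\pi\equiv N^{-d}$ be the uniform distribution on it, and let $\|\psi\|_2=\big(\sum_{x}\pi(x)|\psi(x)|^2\big)^{1/2}$ be the norm of $L^2(\mathbb T^d_N,\pi)$. The averaging process on $\mathbb T^d_N$ is the Markov jump process on the space $\mathcal P(\mathbb T^d_N)$ of probability mass functions on $\mathbb T^d_N$ with infinitesimal generator $$\mathcal L f(\eta)=\frac12\sum_{x\in\mathbb T^d_N}\ \sum_{y:\,|x-y|=1}\big(f(\eta^{xy})-f(\eta)\big),\qquad f\in C(\mathcal P(\mathbb T^d_N)),$$ where $\eta^{xy}(z)=\tfrac12(\eta(x)+\eta(y))$ if $z\in\{x,y\}$ and $\eta^{xy}(z)=\eta(z)$ otherwise. Let $\eta_t(0,\cdot)$ denote this process at time $t$ when started from the Dirac mass at the origin, and write $\mathbb E$ for expectation. Let $t_{\rm rel}=1/\lambda$, where $\lambda$ is the smallest non-zero eigenvalue of $-L^{\rm RW}$, with $L^{\rm RW}\psi(x)=\frac12\sum_{y:\,|x-y|=1}(\psi(y)-\psi(x))$.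 Then for every $d\ge1$ there are constants $B,C>0$, depending only on $d$, such that for all sufficiently large $N$ (how large may depend on $d$) and all $t\ge0$, $$\mathbb E\bigg[\bigg\|\frac{\eta_t(0,\cdot)}{\pi}-1\bigg\|_2^2\bigg]\ \le\ \frac{C\,N^d}{(N^d\wedge t^{d/2})\vee 1}\,\exp\Big(-\frac{2t}{t_{\rm rel}}+\frac{Bt}{N^{d+2}}\Big).$$ -/

import Mathlib

open MeasureTheory Filter Topology
open scoped NNReal

noncomputable section

/-- The uniformly continuous semigroup `e^{tA} = ∑ₖ (tA)ᵏ / k!` generated by a bounded operator `A`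
on a normed space. -/
def expSemigroup {E : Type*} [NormedAddCommGroup E] [NormedSpace ℝ E] (A : E →L[ℝ] E) (t : ℝ) :
    E →L[ℝ] E :=
  NormedSpace.exp (t • A)

/-- The discrete torus `(ℤ/Nℤ)^d`. -/
abbrev DTorus (d N : ℕ) : Type := Fin d → ZMod N

namespace DTorus

variable (d N : ℕ)

/-- The nearest-neighbour graph on the torus: `x` and `y` are adjacent iff they are at graph
distance one, i.e. iff `x ≠ y` and `y = x + e_i` or `x = y + e_i` for some `i`. -/
def graph : SimpleGraph (DTorus d N) :=
  SimpleGraph.fromRel fun x y => ∃ i : Fin d, y = x + Pi.single i 1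

variable [NeZero N]

open Classical in
/-- The finite set of nearest neighbours of `x`. -/
def nbrs (x : DTorus d N) : Finset (DTorus d N) :=
  Finset.univ.filter fun y => (graph d N).Adj x y

/-- Probability mass functions on the torus (with the topology and the Borel `σ`-algebra
inherited from `DTorus d N → ℝ`). -/
abbrev ProbMass : Type := stdSimplex ℝ (DTorus d N)

/-- The uniform distribution `π ≡ 1 / N^d`. -/
def unif (_x : DTorus d N) : ℝ := 1 / (N : ℝ) ^ d

/-- The norm of `L²(𝕋, π)`. -/
def l2norm (ψ : DTorus d N → ℝ) : ℝ := √(∑ x, unif d N x * |ψ x| ^ 2)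

/-! ### Random walk, spectral gap, relaxation time -/

/-- The generator of the lazy simple random walk,
`ψ ↦ (x ↦ (1/2) ∑_{y ∼ x} (ψ y - ψ x))`. -/
def rwGenerator : (DTorus d N → ℝ) →ₗ[ℝ] (DTorus d N → ℝ) where
  toFun ψ x := (1 / 2) * ∑ y ∈ nbrs d N x, (ψ y - ψ x)
  map_add' ψ φ := by
    funext x
    simp only [Pi.add_apply, ← mul_add, ← Finset.sum_add_distrib]
    congr 1
    exact Finset.sum_congr rfl fun y _ => by ring
  map_smul' c ψ := by
    funext x
    simp only [Pi.smul_apply, smul_eq_mul, RingHom.id_apply, ← mul_sub, ← Finset.mul_sum]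
    ring

/-- The spectral gap: the smallest non-zero eigenvalue of minus the generator of the walk
(for `2 ≤ N` and `1 ≤ d` this set is finite and non-empty). -/
def spectralGap : ℝ :=
  sInf {μ : ℝ | μ ≠ 0 ∧ Module.End.HasEigenvalue (-rwGenerator d N) μ}

/-- The relaxation time, the inverse of the spectral gap. -/
def tRel : ℝ := 1 / spectralGap d N

/-! ### The averaging process -/

variable {d N}

open Classical in
/-- The values of `η^{xy}`: the masses at `x` and `y` are replaced by their average. -/
def avgFun (x y : DTorus d N) (η : DTorus d N → ℝ) (z : DTorus d N) : ℝ :=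
  if z = x ∨ z = y then (η x + η y) / 2 else η z

lemma avgFun_mem (x y : DTorus d N) {η : DTorus d N → ℝ} (hη : η ∈ stdSimplex ℝ (DTorus d N)) :
    avgFun x y η ∈ stdSimplex ℝ (DTorus d N) := by
  classical
  refine ⟨fun z => ?_, ?_⟩
  · unfold avgFun
    split_ifs
    · have h1 := hη.1 x
      have h2 := hη.1 y
      linarith
    · exact hη.1 z
  · have key : ∀ z, avgFun x y η z = η z + ((if z = x then (η y - η x) / 2 else 0)
        + (if z = y then (η x - η y) / 2 else 0)) := by
      intro z
      unfold avgFun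
      by_cases h1 : z = x <;> by_cases h2 : z = y
      · subst h1; subst h2; simp
      · subst h1; simp [h2]; ring
      · subst h2; simp [h1]; ring
      · simp [h1, h2]
    simp only [key, Finset.sum_add_distrib, Finset.sum_ite_eq', Finset.mem_univ, if_true]
    rw [hη.2]
    ring

/-- The update `η ↦ η^{xy}` as a continuous self-map of the space of probability mass
functions. -/
def update (x y : DTorus d N) : C(ProbMass d N, ProbMass d N) where
  toFun η := ⟨avgFun x y η.1, avgFun_mem x y η.2⟩
  continuous_toFun := by
    refine Continuous.subtype_mk (continuous_pi fun z => ?_) _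
    unfold avgFun
    split_ifs
    · exact (((continuous_apply x).comp continuous_subtype_val).add
        ((continuous_apply y).comp continuous_subtype_val)).div_const 2
    · exact (continuous_apply z).comp continuous_subtype_val

/-- Composition with the update `η ↦ η^{xy}`, as a bounded operator on `C(𝒫)`. -/
def updateOp (x y : DTorus d N) : C(ProbMass d N, ℝ) →L[ℝ] C(ProbMass d N, ℝ) where
  toLinearMap := (ContinuousMap.compRightAlgHom ℝ ℝ (update x y)).toLinearMap
  cont := ContinuousMap.compRightAlgHom_continuous ℝ ℝ (update x y)

lemma updateOp_apply (x y : DTorus d N) (f : C(ProbMass d N, ℝ)) (η : ProbMass d N) :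
    updateOp x y f η = f (update x y η) := rfl

variable (d N)

/-- The infinitesimal generator of the averaging process, a bounded operator on the Banach space
of continuous functions on the space of probability mass functions. -/
def avgGenerator : C(ProbMass d N, ℝ) →L[ℝ] C(ProbMass d N, ℝ) :=
  (1 / 2 : ℝ) • ∑ x : DTorus d N, ∑ y ∈ nbrs d N x,
    (updateOp x y - ContinuousLinearMap.id ℝ C(ProbMass d N, ℝ))

lemma avgGenerator_apply (f : C(ProbMass d N, ℝ)) (η : ProbMass d N) :
    avgGenerator d N f η
      = (1 / 2) * ∑ x : DTorus d N, ∑ y ∈ nbrs d N x, (f (update x y η) - f η) := by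
  simp [avgGenerator, updateOp_apply]

/-- The Markov semigroup `e^{t𝓛}` on `C(𝒫)` generated by the bounded operator `𝓛`. -/
def avgSemigroup (t : ℝ≥0) : C(ProbMass d N, ℝ) →L[ℝ] C(ProbMass d N, ℝ) :=
  expSemigroup (avgGenerator d N) t

variable {d N}

/-- `η` is a realization, on the probability space `(Ω, P)` with filtration `ℱ`, of the averaging
process started from `ξ`: a Markov jump process with infinitesimal generator `avgGenerator d N`. -/
structure IsAveragingProcess {Ω : Type*} {mΩ : MeasurableSpace Ω} (P : Measure Ω)
    (ℱ : Filtration ℝ≥0 mΩ) (ξ : ProbMass d N) (η : ℝ≥0 → Ω → ProbMass d N) : Prop where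
  /-- The process is adapted. -/
  adapted : ∀ t, Measurable[ℱ t] (η t)
  /-- The process starts from `ξ`. -/
  initial : ∀ᵐ ω ∂P, η 0 ω = ξ
  /-- Almost surely, the trajectory is a right-continuous step function with finitely many jumps in
  each bounded time interval. -/
  jump : ∀ᵐ ω ∂P, ∀ t, (∀ᶠ s in 𝓝[>] t, η s ω = η t ω) ∧
    ∃ ζ : ProbMass d N, ∀ᶠ s in 𝓝[<] t, η s ω = ζ
  /-- Markov property, with transition semigroup `e^{t𝓛}`. -/
  markov : ∀ (f : C(ProbMass d N, ℝ)) (s t : ℝ≥0),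
    P[fun ω => f (η (s + t) ω) | ℱ s] =ᵐ[P] fun ω => avgSemigroup d N t f (η s ω)

open Classical in
/-- The Dirac mass at the origin of the torus. -/
def dirac0 : ProbMass d N := stdSimplex.vertex 0

end DTorus

end

noncomputable section

namespace DTorus

set_option linter.unusedSectionVars false

variable {d N : ℕ} [NeZero N]

/-! The squared distance to equilibrium equals N^d Σ η(a)² - 1, so only the correlations Σ_a
η(a)η(a+z) matter. Summed over the translates of an edge, their update is again a combination of
correlations (`avgGenerator_corr`), so their mean u_t solves a linear heat equation for the
displacement z: nearest-neighbour diffusion, slowed by one half on the edges at the origin, started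
from δ_0. Its generator is symmetric on even functions, hence u_t(0) = Σ u_{t/2}(z)²
(`IsDiffFlow.apply_zero_eq`), and it remains to bound the ℓ² norm of u - N^{-d}.

The slowed edges cost at most half of the Dirichlet energy, so a Nash inequality (`nash`) gives
decay s^{-d/2} up to times of order N² (`IsDiffFlow.poly_decay`). After that the gap takes over. A
defect at a single site moves it by only O(N^{-d-2}), because the lowest Fourier modes put little of
their energy near the origin (`sum_grad_zero_le_energy`, `IsDiffFlow.exp_decay`). The unperturbed
rate is compared with the relaxation time through an explicit cosine eigenfunction
(`spectralGap_le`). -/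

/-- The coordinate vector `e_i` of the torus. -/
def basisVec (N : ℕ) {d : ℕ} (i : Fin d) : DTorus d N := Pi.single i 1

lemma basisVec_same (i : Fin d) : basisVec N i i = 1 := Pi.single_eq_same i 1

lemma basisVec_injective (hN : 3 ≤ N) : Function.Injective (basisVec N (d := d)) := by
  intro i j h
  by_contra hij
  have : Fact (1 < N) := ⟨by omega⟩
  have := congrFun h i
  simp [basisVec, hij] at this

lemma neg_basisVec_ne (hN : 3 ≤ N) (i j : Fin d) : basisVec N i ≠ -basisVec N j := by
  intro h
  have : Fact (1 < N) := ⟨by omega⟩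
  have h1 := congrFun h i
  by_cases hij : i = j
  · subst hij
    simp only [basisVec, Pi.single_eq_same, Pi.neg_apply] at h1
    have h2 : ((2 : ℕ) : ZMod N) = 0 := by
      push_cast
      linear_combination h1
    rw [ZMod.natCast_eq_zero_iff] at h2
    exact absurd (Nat.le_of_dvd (by norm_num) h2) (by omega)
  · simp [basisVec, hij] at h1

lemma basisVec_ne_zero (hN : 3 ≤ N) (i : Fin d) : basisVec N i ≠ 0 := by
  intro h
  have : Fact (1 < N) := ⟨by omega⟩
  have := congrFun h i
  simp [basisVec] at this

/-- Sums over the nearest neighbours of `x`. -/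
lemma sum_nbrs {M : Type*} [AddCommMonoid M] (hN : 3 ≤ N) (x : DTorus d N) (g : DTorus d N → M) :
    ∑ y ∈ nbrs d N x, g y = ∑ i, (g (x + basisVec N i) + g (x - basisVec N i)) := by
  classical
  have hset : nbrs d N x = (Finset.univ.image fun i : Fin d => x + basisVec N i) ∪
      (Finset.univ.image fun i : Fin d => x - basisVec N i) := by
    ext y
    simp only [nbrs, graph, SimpleGraph.fromRel_adj, Finset.mem_filter, Finset.mem_univ, true_and,
      Finset.mem_union, Finset.mem_image]
    constructor
    · rintro ⟨-, ⟨i, hi⟩ | ⟨i, hi⟩⟩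
      · exact Or.inl ⟨i, hi.symm⟩
      · exact Or.inr ⟨i, by rw [hi]; exact add_sub_cancel_right _ _⟩
    · rintro (⟨i, rfl⟩ | ⟨i, rfl⟩)
      · refine ⟨fun h => basisVec_ne_zero hN i ?_, Or.inl ⟨i, rfl⟩⟩
        simpa using h
      · refine ⟨fun h => basisVec_ne_zero hN i ?_, Or.inr ⟨i, ?_⟩⟩
        · simpa using h.symm
        · exact (sub_add_cancel x (basisVec N i)).symm
  rw [hset, Finset.sum_union, Finset.sum_image, Finset.sum_image, Finset.sum_add_distrib]
  · intro i _ j _ h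
    exact basisVec_injective hN (sub_right_injective h)
  · intro i _ j _ h
    exact basisVec_injective hN (add_right_injective x h)
  · rw [Finset.disjoint_left]
    simp only [Finset.mem_image, Finset.mem_univ, true_and, not_exists]
    rintro _ ⟨i, rfl⟩ j h
    refine neg_basisVec_ne hN j i ?_
    rw [sub_eq_add_neg] at h
    exact neg_injective (by simpa using add_right_injective x h)

/-! ### The correlation function of a mass configuration -/

/-- The spatial correlation `∑ₐ η(a) η(a + z)` of a configuration. -/
def corrSum (η : DTorus d N → ℝ) (z : DTorus d N) : ℝ := ∑ a, η a * η (a + z)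

lemma sum_shift_mul_shift (η : DTorus d N → ℝ) (a b : DTorus d N) :
    ∑ x, η (x + a) * η (x + b) = corrSum η (b - a) := by
  refine Fintype.sum_equiv (Equiv.addRight a) _ _ fun x => ?_
  simp only [Equiv.coe_addRight]
  congr 2
  abel

lemma corrSum_neg (η : DTorus d N → ℝ) (z : DTorus d N) : corrSum η (-z) = corrSum η z := by
  have h := sum_shift_mul_shift η z 0
  rw [zero_sub] at h
  rw [← h, corrSum]
  exact Finset.sum_congr rfl fun x _ => by rw [add_zero, mul_comm]

open Classical in
lemma avgFun_eq_add (x y : DTorus d N) (η : DTorus d N → ℝ) (a : DTorus d N) :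
    avgFun x y η a = η a
      + (η y - η x) / 2 * ((if a = x then 1 else 0) - (if a = y then 1 else 0)) := by
  unfold avgFun
  by_cases h1 : a = x <;> by_cases h2 : a = y
  · subst h1; subst h2; simp
  · subst h1; simp [h2]; ring
  · subst h2; simp [h1]; ring
  · simp [h1, h2]

-- Averaging adds c(1_x - 1_y) to η, with c = (η(y) - η(x))/2. The two terms on the right are the
-- parts linear and quadratic in c.
open Classical in
lemma corrSum_avgFun (x y : DTorus d N) (η : DTorus d N → ℝ) (z : DTorus d N) :
    corrSum (avgFun x y η) z - corrSum η z =
      (η y - η x) / 2 * ((η (x + z) - η (y + z)) + (η (x - z) - η (y - z)))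
      + ((η y - η x) / 2) ^ 2 * (2 * (if z = 0 then 1 else 0) - (if z = y - x then 1 else 0)
        - (if z = -(y - x) then 1 else 0)) := by
  set c := (η y - η x) / 2 with hc
  have h1 : ∀ a w : DTorus d N, (if a + z = w then (1 : ℝ) else 0) = if a = w - z then 1 else 0 := by
    intro a w
    simp only [eq_sub_iff_add_eq]
  have h2 : ∀ a, avgFun x y η a * avgFun x y η (a + z) - η a * η (a + z) =
      c * ((if a = x then η (a + z) else 0) - (if a = y then η (a + z) else 0))
      + c * ((if a = x - z then η a else 0) - (if a = y - z then η a else 0))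
      + c ^ 2 * ((if a = x then (if x + z = x then 1 else 0) else 0)
        - (if a = x then (if x + z = y then 1 else 0) else 0)
        - (if a = y then (if y + z = x then 1 else 0) else 0)
        + (if a = y then (if y + z = y then 1 else 0) else 0)) := by
    intro a
    rw [avgFun_eq_add, avgFun_eq_add, ← hc]
    have e1 : ∀ w : DTorus d N, (if a = w - z then η a else 0)
        = η a * (if a + z = w then 1 else 0) := by
      intro w
      rw [h1]; simp
    have e2 : ∀ w : DTorus d N, (if a = w then η (a + z) else 0)
        = η (a + z) * (if a = w then 1 else 0) := by
      intro w
      simp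
    have e3 : ∀ w v : DTorus d N, (if a = w then (if w + z = v then (1 : ℝ) else 0) else 0)
        = (if a = w then 1 else 0) * (if a + z = v then 1 else 0) := by
      intro w v
      by_cases h : a = w
      · subst h; simp
      · simp [h]
    simp only [e1, e2, e3]
    ring
  unfold corrSum
  rw [← Finset.sum_sub_distrib]
  simp only [h2, Finset.sum_add_distrib, Finset.sum_sub_distrib, ← Finset.mul_sum,
    Finset.sum_ite_eq', Finset.mem_univ, if_true]
  have i1 : ∀ w : DTorus d N, (w + z = w) = (z = 0) := by intro w; simp
  have i2 : (x + z = y) = (z = y - x) := by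
    rw [eq_sub_iff_add_eq, add_comm]
  have i3 : (y + z = x) = (z = -(y - x)) := by
    rw [neg_sub, eq_sub_iff_add_eq, add_comm]
  simp only [i1, i2, i3]
  ring

/-- The generator of the difference process: the walk on the torus with conductances `1`, except for
the edges at the origin, whose conductance is `1 / 2` (on even functions). -/
def diffGen {M : Type*} [AddCommGroup M] [Module ℝ M] (u : DTorus d N → M) (z : DTorus d N) : M :=
  open Classical in
  ∑ i, (u (z - basisVec N i) + u (z + basisVec N i) - (2 : ℝ) • u z
    + ((1 / 2 : ℝ) * (2 * (if z = 0 then 1 else 0) - (if z = basisVec N i then 1 else 0)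
        - (if z = -basisVec N i then 1 else 0))) • (u 0 - u (basisVec N i)))

-- Summing over x turns every product of shifted values of η into a correlation, so the equation
-- closes. The quadratic part survives only at z = 0, ±e and produces the defect at the origin.
open Classical in
lemma sum_corrSum_avgFun_add (η : DTorus d N → ℝ) (e z : DTorus d N) :
    ∑ x, (corrSum (avgFun x (x + e) η) z - corrSum η z) =
      corrSum η (z - e) + corrSum η (z + e) - 2 * corrSum η z
      + 1 / 2 * (2 * (if z = 0 then 1 else 0) - (if z = e then 1 else 0)
        - (if z = -e then 1 else 0)) * (corrSum η 0 - corrSum η e) := by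
  have key : ∀ x, corrSum (avgFun x (x + e) η) z - corrSum η z =
      1 / 2 * (η (x + e) * η (x + z) - η (x + e) * η (x + (e + z)) - η (x + 0) * η (x + z)
        + η (x + 0) * η (x + (e + z)) + η (x + e) * η (x + -z) - η (x + e) * η (x + (e - z))
        - η (x + 0) * η (x + -z) + η (x + 0) * η (x + (e - z)))
      + 1 / 4 * (2 * (if z = 0 then 1 else 0) - (if z = e then 1 else 0)
        - (if z = -e then 1 else 0)) * (η (x + e) * η (x + e) - 2 * (η (x + 0) * η (x + e))
          + η (x + 0) * η (x + 0)) := by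
    intro x
    rw [corrSum_avgFun]
    simp only [add_sub_cancel_left, add_zero, ← add_assoc, ← sub_eq_add_neg, ← add_sub_assoc]
    ring
  simp only [key, Finset.sum_add_distrib, Finset.sum_sub_distrib, ← Finset.mul_sum,
    sum_shift_mul_shift]
  have r1 : -z - e = -(z + e) := by abel
  have r2 : e - z - e = -z := by abel
  have r3 : e - z = -(z - e) := by abel
  have r4 : e + z - e = z := by abel
  have r5 : e + z = z + e := by abel
  simp only [sub_zero, sub_self, r4, r2, r1, corrSum_neg]
  rw [r3, r5, corrSum_neg]
  ring

/-- The spatial correlation as a continuous function of the mass configuration. -/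
def corr (z : DTorus d N) : C(ProbMass d N, ℝ) where
  toFun η := corrSum η.1 z
  continuous_toFun := by
    unfold corrSum
    exact continuous_finsetSum _ fun a _ =>
      ((continuous_apply a).comp continuous_subtype_val).mul
        ((continuous_apply (a + z)).comp continuous_subtype_val)

lemma corr_neg (z : DTorus d N) : corr (-z) = corr z := ContinuousMap.ext fun η => corrSum_neg η.1 z

lemma avgGenerator_corr (hN : 3 ≤ N) (z : DTorus d N) :
    avgGenerator d N (corr z) = diffGen corr z := by
  classical
  ext η
  rw [avgGenerator_apply]
  simp only [sum_nbrs hN]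
  rw [Finset.sum_comm]
  have h : ∀ i : Fin d, ∑ x : DTorus d N, ((corr z (update x (x + basisVec N i) η) - corr z η)
      + (corr z (update x (x - basisVec N i) η) - corr z η)) =
      2 * (corr (z - basisVec N i) + corr (z + basisVec N i) - (2 : ℝ) • corr z
      + ((1 / 2 : ℝ) * (2 * (if z = 0 then 1 else 0) - (if z = basisVec N i then 1 else 0)
        - (if z = -basisVec N i then 1 else 0))) • (corr 0 - corr (basisVec N i)) :
          C(ProbMass d N, ℝ)) η := by
    intro i
    rw [Finset.sum_add_distrib]
    have h1 := sum_corrSum_avgFun_add η.1 (basisVec N i) z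
    -- By evenness of the correlation, the direction -e_i contributes the same as e_i; the resulting
    -- factor 2 cancels the 1/2 in the generator.
    have h2 := sum_corrSum_avgFun_add η.1 (-basisVec N i) z
    simp only [← sub_eq_add_neg, sub_neg_eq_add, neg_neg, corrSum_neg] at h2
    have e1 : ∀ x y, (corr z (update x y η) : ℝ) = corrSum (avgFun x y η.1) z := fun _ _ => rfl
    have e2 : ∀ w, corr w η = corrSum η.1 w := fun _ => rfl
    simp only [e1, e2, h1, h2, ContinuousMap.add_apply, ContinuousMap.sub_apply,
      ContinuousMap.smul_apply, smul_eq_mul]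
    ring
  simp only [h, diffGen, ← Finset.mul_sum, ContinuousMap.sum_apply]
  ring

/-! ### The averaged correlation function -/

/-- The expected correlation function of the averaging process started at the origin. -/
def meanCorr (d N : ℕ) [NeZero N] (t : ℝ) (z : DTorus d N) : ℝ :=
  expSemigroup (avgGenerator d N) t (corr z) dirac0

lemma meanCorr_neg (t : ℝ) (z : DTorus d N) : meanCorr d N t (-z) = meanCorr d N t z := by
  rw [meanCorr, corr_neg, meanCorr]

lemma hasDerivAt_meanCorr (hN : 3 ≤ N) (t : ℝ) (z : DTorus d N) :
    HasDerivAt (fun s => meanCorr d N s z) (diffGen (meanCorr d N t) z) t := by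
  classical
  have h : HasDerivAt (fun s => expSemigroup (avgGenerator d N) s)
      (expSemigroup (avgGenerator d N) t * avgGenerator d N) t :=
    hasDerivAt_exp_smul_const (𝕂 := ℝ) (avgGenerator d N) t
  -- Evaluation at `corr z` and then at the Dirac mass is a bounded functional, so it commutes with
  -- differentiating the operator semigroup.
  let ev : (C(ProbMass d N, ℝ) →L[ℝ] C(ProbMass d N, ℝ)) →L[ℝ] ℝ :=
    (ContinuousMap.evalCLM ℝ (dirac0 : ProbMass d N)).comp
      (ContinuousLinearMap.apply ℝ C(ProbMass d N, ℝ) (corr z))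
  have h2 := ev.hasFDerivAt.comp_hasDerivAt t h
  refine h2.congr_deriv ?_
  change (expSemigroup (avgGenerator d N) t) (avgGenerator d N (corr z)) dirac0 = _
  rw [avgGenerator_corr hN]
  simp only [diffGen, map_sum, map_add, map_sub, map_smul, ContinuousMap.sum_apply,
    ContinuousMap.add_apply, ContinuousMap.sub_apply, ContinuousMap.smul_apply]
  rfl

lemma meanCorr_zero (z : DTorus d N) : meanCorr d N 0 z = corrSum (dirac0 : ProbMass d N).1 z := by
  simp [meanCorr, expSemigroup, corr]

open Classical in
lemma meanCorr_zero_eq (z : DTorus d N) : meanCorr d N 0 z = if z = 0 then 1 else 0 := by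
  rw [meanCorr_zero]
  have h : ∀ a, (dirac0 : ProbMass d N).1 a = if a = 0 then 1 else 0 := by
    intro a
    simp [dirac0, stdSimplex.vertex, Pi.single_apply]
  simp only [corrSum, h]
  rw [Finset.sum_eq_single 0]
  · simp
  · intro b _ hb
    simp [hb]
  · simp

/-! ### Expectations along the process. -/

lemma IsAveragingProcess.integral_eq {Ω : Type*} {mΩ : MeasurableSpace Ω} {P : Measure Ω}
    [IsProbabilityMeasure P] {ℱ : Filtration ℝ≥0 mΩ} {ξ : ProbMass d N}
    {η : ℝ≥0 → Ω → ProbMass d N} (h : IsAveragingProcess P ℱ ξ η)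
    (f : C(ProbMass d N, ℝ)) (t : ℝ≥0) : ∫ ω, f (η t ω) ∂P = avgSemigroup d N t f ξ := by
  have h1 := h.markov f 0 t
  rw [← integral_condExp (ℱ.le 0)]
  rw [zero_add] at h1
  rw [integral_congr_ae h1]
  have h2 : (fun ω => avgSemigroup d N t f (η 0 ω)) =ᵐ[P] fun _ => avgSemigroup d N t f ξ := by
    filter_upwards [h.initial] with ω hω
    rw [hω]
  rw [integral_congr_ae h2]
  simp

lemma IsAveragingProcess.integral_corr {Ω : Type*} {mΩ : MeasurableSpace Ω} {P : Measure Ω}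
    [IsProbabilityMeasure P] {ℱ : Filtration ℝ≥0 mΩ} {η : ℝ≥0 → Ω → ProbMass d N}
    (h : IsAveragingProcess P ℱ dirac0 η) (t : ℝ≥0) (z : DTorus d N) :
    ∫ ω, corrSum (η t ω).1 z ∂P = meanCorr d N t z :=
  h.integral_eq (corr z) t

/-- Positivity is read off the process, as the mean of a sum of products of masses, instead of from
a maximum principle for `diffGen`. -/
lemma IsAveragingProcess.meanCorr_nonneg {Ω : Type*} {mΩ : MeasurableSpace Ω} {P : Measure Ω}
    [IsProbabilityMeasure P] {ℱ : Filtration ℝ≥0 mΩ} {η : ℝ≥0 → Ω → ProbMass d N}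
    (h : IsAveragingProcess P ℱ dirac0 η) {t : ℝ} (ht : 0 ≤ t) (z : DTorus d N) :
    0 ≤ meanCorr d N t z := by
  have : _ = meanCorr d N t z := h.integral_corr ⟨t, ht⟩ z
  rw [← this]
  exact integral_nonneg fun ω => Finset.sum_nonneg fun a _ => mul_nonneg ((η _ ω).2.1 a) ((η _ ω).2.1 _)

lemma sum_corrSum (η : DTorus d N → ℝ) : ∑ z, corrSum η z = (∑ x, η x) ^ 2 := by
  unfold corrSum
  rw [Finset.sum_comm, sq, Finset.sum_mul]
  refine Finset.sum_congr rfl fun a _ => ?_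
  rw [← Finset.mul_sum]
  congr 1
  exact Equiv.sum_comp (Equiv.addLeft a) η

lemma IsAveragingProcess.sum_meanCorr {Ω : Type*} {mΩ : MeasurableSpace Ω} {P : Measure Ω}
    [IsProbabilityMeasure P] {ℱ : Filtration ℝ≥0 mΩ} {η : ℝ≥0 → Ω → ProbMass d N}
    (h : IsAveragingProcess P ℱ dirac0 η) {t : ℝ} (ht : 0 ≤ t) :
    ∑ z, meanCorr d N t z = 1 := by
  have h1 := h.integral_eq (∑ z, corr z) ⟨t, ht⟩
  have h2 : ∀ ω, (∑ z, corr z : C(ProbMass d N, ℝ)) (η ⟨t, ht⟩ ω) = 1 := by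
    intro ω
    rw [ContinuousMap.sum_apply]
    change ∑ z, corrSum (η ⟨t, ht⟩ ω).1 z = 1
    rw [sum_corrSum, (η ⟨t, ht⟩ ω).2.2, one_pow]
  simp only [h2, map_sum, ContinuousMap.sum_apply] at h1
  refine Eq.trans ?_ (h1.symm.trans (by simp))
  rfl

lemma l2norm_sub_one_sq (η : ProbMass d N) :
    l2norm d N (fun x => η.1 x / unif d N x - 1) ^ 2 = (N : ℝ) ^ d * corrSum η.1 0 - 1 := by
  have hN : (0 : ℝ) < (N : ℝ) ^ d := by
    have := NeZero.pos N
    positivity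
  unfold l2norm
  rw [Real.sq_sqrt (Finset.sum_nonneg fun x _ => by unfold unif; positivity)]
  have h : ∀ x, unif d N x * |η.1 x / unif d N x - 1| ^ 2
      = (N : ℝ) ^ d * (η.1 x * η.1 (x + 0)) - 2 * η.1 x + 1 / (N : ℝ) ^ d := by
    intro x
    rw [sq_abs, unif, add_zero]
    field_simp
    ring
  simp only [h, Finset.sum_add_distrib, Finset.sum_sub_distrib, ← Finset.mul_sum, η.2.2]
  simp only [corrSum, Finset.sum_const, Finset.card_univ, Fintype.card_fun, ZMod.card,
    Fintype.card_fin, nsmul_eq_mul]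
  push_cast
  field_simp
  ring

lemma IsAveragingProcess.integral_l2norm {Ω : Type*} {mΩ : MeasurableSpace Ω} {P : Measure Ω}
    [IsProbabilityMeasure P] {ℱ : Filtration ℝ≥0 mΩ} {η : ℝ≥0 → Ω → ProbMass d N}
    (h : IsAveragingProcess P ℱ dirac0 η) (t : ℝ≥0) :
    ∫ ω, l2norm d N (fun x => (η t ω).1 x / unif d N x - 1) ^ 2 ∂P
      = (N : ℝ) ^ d * meanCorr d N t 0 - 1 := by
  simp only [l2norm_sub_one_sq]
  have h1 := h.integral_eq ((N : ℝ) ^ d • corr 0 - ContinuousMap.const _ 1) t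
  have h2 := h.integral_eq (ContinuousMap.const _ 1) t
  rw [map_sub, map_smul, ContinuousMap.sub_apply, ContinuousMap.smul_apply, ← h2] at h1
  refine h1.trans ?_
  simp [meanCorr, avgSemigroup]

/-! ### Fourier analysis on the torus -/

/-- The Fourier symbol of the one-dimensional discrete Laplacian. -/
def freq (k : ZMod N) : ℝ := ‖(ZMod.stdAddChar k : ℂ) - 1‖ ^ 2

lemma freq_nonneg (k : ZMod N) : 0 ≤ freq k := sq_nonneg _

/-- The centred representative keeps the half-angle in [0, π/2], where sine is monotone. -/
lemma freq_eq (k : ZMod N) :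
    freq k = 4 * Real.sin (Real.pi * (k.valMinAbs.natAbs : ℝ) / N) ^ 2 := by
  have h := ZMod.stdAddChar_coe (N := N) k.valMinAbs
  rw [ZMod.coe_valMinAbs] at h
  have h2 : (2 * Real.pi * Complex.I * (k.valMinAbs : ℂ) / N : ℂ)
      = Complex.I * ((2 * (Real.pi * k.valMinAbs / N) : ℝ) : ℂ) := by
    push_cast
    ring
  rw [freq, h, h2, Complex.norm_exp_I_mul_ofReal_sub_one, Real.norm_eq_abs, sq_abs, mul_pow]
  rw [mul_div_cancel_left₀ _ (two_ne_zero' ℝ)]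
  norm_num
  rcases Int.natAbs_eq k.valMinAbs with h3 | h3
  · have h4 : (k.valMinAbs : ℝ) = (k.valMinAbs.natAbs : ℝ) := by
      conv_lhs => rw [h3]
      simp
    rw [h4]; simp
  · have h4 : (k.valMinAbs : ℝ) = -(k.valMinAbs.natAbs : ℝ) := by
      conv_lhs => rw [h3]
      simp
    rw [h4, mul_neg, neg_div, Real.sin_neg, neg_sq]; simp

/-- The smallest non-zero value of the Fourier symbol. -/
def lam (N : ℕ) : ℝ := 4 * Real.sin (Real.pi / N) ^ 2

lemma lam_nonneg (N : ℕ) : 0 ≤ lam N := by unfold lam; positivity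

lemma lam_le (N : ℕ) : lam N ≤ 40 / (N : ℝ) ^ 2 := by
  have h : |Real.sin (Real.pi / N)| ≤ |Real.pi / N| := Real.abs_sin_le_abs
  have h1 := sq_le_sq.mpr h
  have h2 : Real.pi ^ 2 ≤ 10 := by nlinarith [Real.pi_lt_d2, Real.pi_pos]
  unfold lam
  calc 4 * Real.sin (Real.pi / N) ^ 2 ≤ 4 * (Real.pi / N) ^ 2 := by linarith
    _ = 4 * Real.pi ^ 2 / (N : ℝ) ^ 2 := by rw [div_pow]; ring
    _ ≤ 40 / (N : ℝ) ^ 2 := by gcongr; linarith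

lemma angle_le (k : ZMod N) : Real.pi * (k.valMinAbs.natAbs : ℝ) / N ≤ Real.pi / 2 := by
  have hN : (0 : ℝ) < N := by exact_mod_cast NeZero.pos N
  have h := ZMod.natAbs_valMinAbs_le k
  have h2 : (k.valMinAbs.natAbs : ℝ) ≤ N / 2 := by
    rw [le_div_iff₀ (by norm_num)]
    have : k.valMinAbs.natAbs * 2 ≤ N := by omega
    exact_mod_cast this
  rw [div_le_iff₀ hN]
  nlinarith [Real.pi_pos]

lemma sin_sq_le_sin_sq {a b : ℝ} (ha : 0 ≤ a) (hab : a ≤ b) (hb : b ≤ Real.pi / 2) :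
    Real.sin a ^ 2 ≤ Real.sin b ^ 2 := by
  have h1 := Real.sin_le_sin_of_le_of_le_pi_div_two (by linarith [Real.pi_pos]) hb hab
  have h0 := Real.sin_nonneg_of_nonneg_of_le_pi ha (by linarith [Real.pi_pos])
  exact pow_le_pow_left₀ h0 h1 2

lemma le_freq_of_le (k : ZMod N) {m : ℕ} (hm : m ≤ k.valMinAbs.natAbs) :
    4 * Real.sin (Real.pi * m / N) ^ 2 ≤ freq k := by
  rw [freq_eq]
  refine mul_le_mul_of_nonneg_left (sin_sq_le_sin_sq (by positivity) ?_ (angle_le k)) (by norm_num)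
  have := Real.pi_pos
  gcongr

lemma lam_le_freq {k : ZMod N} (hk : k ≠ 0) : lam N ≤ freq k := by
  have h : 1 ≤ k.valMinAbs.natAbs := by
    rw [Nat.one_le_iff_ne_zero, Int.natAbs_ne_zero]
    rwa [Ne, ZMod.valMinAbs_eq_zero]
  simpa [lam] using le_freq_of_le k h

/-- By the double-angle formula sin²(2x) = 4 cos²x sin²x, and cos²x ≥ 3/4 for x = π/N ≤ π/6; this is
where N ≥ 6 is needed. -/
lemma three_lam_le_freq (hN : 6 ≤ N) {k : ZMod N} (hk : 2 ≤ k.valMinAbs.natAbs) :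
    3 * lam N ≤ freq k := by
  refine le_trans ?_ (le_freq_of_le k hk)
  have hN' : (6 : ℝ) ≤ N := by exact_mod_cast hN
  have hpi := Real.pi_pos
  have h1 : Real.pi * (2 : ℕ) / N = 2 * (Real.pi / N) := by push_cast; ring
  have h2 : Real.pi / N ≤ Real.pi / 6 := by gcongr
  have h3 : Real.cos (Real.pi / 6) ≤ Real.cos (Real.pi / N) :=
    Real.cos_le_cos_of_nonneg_of_le_pi (by positivity) (by linarith) h2
  rw [Real.cos_pi_div_six] at h3
  have h4 : 3 / 4 ≤ Real.cos (Real.pi / N) ^ 2 := by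
    have := pow_le_pow_left₀ (by positivity) h3 2
    rw [div_pow, Real.sq_sqrt (by norm_num)] at this
    linarith
  rw [h1, Real.sin_two_mul, lam]
  nlinarith [sq_nonneg (Real.sin (Real.pi / N))]

lemma freq_le_lam {k : ZMod N} (hN : 2 ≤ N) (hk : k.valMinAbs.natAbs ≤ 1) : freq k ≤ lam N := by
  have hN' : (2 : ℝ) ≤ N := by exact_mod_cast hN
  have hpi := Real.pi_pos
  have h1 : (k.valMinAbs.natAbs : ℝ) ≤ 1 := by exact_mod_cast hk
  rw [freq_eq, lam]
  refine mul_le_mul_of_nonneg_left (sin_sq_le_sin_sq (by positivity) ?_ ?_) (by norm_num)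
  · gcongr
    nlinarith
  · gcongr

/-- Jordan's inequality sin x ≥ 2x/π on [0, π/2]. -/
lemma sq_le_freq (k : ZMod N) : 16 * ((k.valMinAbs.natAbs : ℝ) / N) ^ 2 ≤ freq k := by
  have hpi := Real.pi_pos
  have h := Real.mul_le_sin (x := Real.pi * (k.valMinAbs.natAbs : ℝ) / N) (by positivity) (angle_le k)
  have h1 : 2 / Real.pi * (Real.pi * (k.valMinAbs.natAbs : ℝ) / N)
      = 2 * ((k.valMinAbs.natAbs : ℝ) / N) := by
    field_simp
  rw [h1] at h
  have h2 := pow_le_pow_left₀ (by positivity) h 2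
  rw [freq_eq]
  linarith [h2, mul_pow 2 ((k.valMinAbs.natAbs : ℝ) / N) 2]

lemma norm_stdAddChar (j : ZMod N) : ‖(ZMod.stdAddChar j : ℂ)‖ = 1 := by
  rw [ZMod.stdAddChar_apply, Circle.norm_coe]

lemma conj_stdAddChar (j : ZMod N) :
    (starRingEnd ℂ) (ZMod.stdAddChar j) = ZMod.stdAddChar (-j) := by
  rw [ZMod.stdAddChar_apply, ZMod.stdAddChar_apply, ← Circle.coe_inv_eq_conj, AddChar.map_neg_eq_inv]

lemma sum_stdAddChar_dotProduct (v : DTorus d N) :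
    ∑ x : DTorus d N, (ZMod.stdAddChar (x ⬝ᵥ v) : ℂ) = if v = 0 then (N : ℂ) ^ d else 0 := by
  classical
  have h1 : ∀ x : DTorus d N, (ZMod.stdAddChar (x ⬝ᵥ v) : ℂ)
      = ∏ i, (ZMod.stdAddChar (x i * v i) : ℂ) := by
    intro x
    exact map_prod ZMod.stdAddChar.toMonoidHom (fun i => Multiplicative.ofAdd (x i * v i)) Finset.univ
  simp only [h1]
  have h2 := Finset.sum_prod_piFinset (Finset.univ : Finset (ZMod N))
    (fun (i : Fin d) a => (ZMod.stdAddChar (a * v i) : ℂ))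
  rw [Fintype.piFinset_univ] at h2
  rw [h2]
  simp only [AddChar.sum_mulShift _ (ZMod.isPrimitive_stdAddChar N), ZMod.card]
  split_ifs with h
  · subst h
    simp
  · obtain ⟨i, hi⟩ := Function.ne_iff.mp h
    exact Finset.prod_eq_zero (Finset.mem_univ i) (by rw [if_neg (show ¬ v i = 0 from hi), Nat.cast_zero])

/-- The function on the torus with Fourier coefficients `c`. -/
def synth (c : DTorus d N → ℂ) (x : DTorus d N) : ℂ := ∑ k, c k * ZMod.stdAddChar (k ⬝ᵥ x)

/-- Parseval's identity, from orthogonality of characters. -/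
lemma sum_norm_sq_synth (c : DTorus d N → ℂ) :
    ∑ x, ‖synth c x‖ ^ 2 = (N : ℝ) ^ d * ∑ k, ‖c k‖ ^ 2 := by
  classical
  have key : ∑ x, synth c x * (starRingEnd ℂ) (synth c x)
      = (N : ℂ) ^ d * ∑ k, c k * (starRingEnd ℂ) (c k) := by
    have h1 : ∀ x, synth c x * (starRingEnd ℂ) (synth c x) =
        ∑ k, ∑ l, c k * (starRingEnd ℂ) (c l) * ZMod.stdAddChar (x ⬝ᵥ (k - l)) := by
      intro x
      rw [synth, map_sum, Finset.sum_mul_sum]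
      refine Finset.sum_congr rfl fun k _ => Finset.sum_congr rfl fun l _ => ?_
      rw [map_mul, conj_stdAddChar, dotProduct_sub, sub_eq_add_neg, AddChar.map_add_eq_mul,
        dotProduct_comm x k, dotProduct_comm x l]
      ring
    simp only [h1]
    rw [Finset.sum_comm, Finset.mul_sum]
    refine Finset.sum_congr rfl fun k _ => ?_
    rw [Finset.sum_comm]
    simp only [← Finset.mul_sum, sum_stdAddChar_dotProduct, sub_eq_zero]
    rw [Finset.sum_eq_single k]
    · simp; ring
    · intro l _ hl
      rw [if_neg (Ne.symm hl), mul_zero]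
    · simp
  simp only [Complex.mul_conj, Complex.normSq_eq_norm_sq] at key
  exact_mod_cast key

/-- The normalized Fourier coefficients of a function on the torus. -/
def coeff (f : DTorus d N → ℝ) (k : DTorus d N) : ℂ :=
  ((N : ℂ) ^ d)⁻¹ * ∑ y, (f y : ℂ) * ZMod.stdAddChar (-(k ⬝ᵥ y))

lemma synth_coeff (f : DTorus d N → ℝ) (x : DTorus d N) : synth (coeff f) x = f x := by
  classical
  have hN : ((N : ℂ) ^ d) ≠ 0 := pow_ne_zero _ (by exact_mod_cast NeZero.ne N)
  have h1 : ∀ k, coeff f k * ZMod.stdAddChar (k ⬝ᵥ x)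
      = ((N : ℂ) ^ d)⁻¹ * ∑ y, (f y : ℂ) * ZMod.stdAddChar (k ⬝ᵥ (x - y)) := by
    intro k
    rw [coeff, mul_assoc, Finset.sum_mul]
    congr 1
    refine Finset.sum_congr rfl fun y _ => ?_
    rw [dotProduct_sub, sub_eq_add_neg, AddChar.map_add_eq_mul]
    ring
  rw [synth]
  simp only [h1, ← Finset.mul_sum]
  rw [Finset.sum_comm]
  simp only [← Finset.mul_sum, sum_stdAddChar_dotProduct, sub_eq_zero]
  rw [Finset.sum_eq_single x]
  · rw [if_pos rfl]
    field_simp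
  · intro y _ hy
    rw [if_neg (Ne.symm hy), mul_zero]
  · simp

lemma coeff_zero (f : DTorus d N → ℝ) (hf : ∑ x, f x = 0) : coeff f 0 = 0 := by
  have h : (∑ x, (f x : ℂ)) = 0 := by exact_mod_cast hf
  simp [coeff, h]

lemma norm_coeff_le (f : DTorus d N → ℝ) (k : DTorus d N) :
    ‖coeff f k‖ ≤ ((N : ℝ) ^ d)⁻¹ * ∑ x, |f x| := by
  rw [coeff, norm_mul, norm_inv, norm_pow, Complex.norm_natCast]
  gcongr
  refine (norm_sum_le _ _).trans (le_of_eq (Finset.sum_congr rfl fun y _ => ?_))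
  rw [norm_mul, norm_stdAddChar, mul_one, Complex.norm_real, Real.norm_eq_abs]

lemma synth_add_sub (c : DTorus d N → ℂ) (x e : DTorus d N) :
    synth c (x + e) - synth c x
      = synth (fun k => c k * ((ZMod.stdAddChar (k ⬝ᵥ e) : ℂ) - 1)) x := by
  simp only [synth]
  rw [← Finset.sum_sub_distrib]
  refine Finset.sum_congr rfl fun k _ => ?_
  rw [dotProduct_add, AddChar.map_add_eq_mul]
  ring

lemma dotProduct_basisVec (k : DTorus d N) (i : Fin d) : k ⬝ᵥ basisVec N i = k i := by
  rw [basisVec, dotProduct_single, mul_one]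

lemma sum_norm_sq_grad_synth (c : DTorus d N → ℂ) (i : Fin d) :
    ∑ x, ‖synth c (x + basisVec N i) - synth c x‖ ^ 2
      = (N : ℝ) ^ d * ∑ k, ‖c k‖ ^ 2 * freq (k i) := by
  simp only [synth_add_sub, sum_norm_sq_synth, norm_mul, mul_pow, dotProduct_basisVec, freq]

/-- The Dirichlet energy `∑ |f(x + e_i) - f(x)|²`. -/
def energy (f : DTorus d N → ℝ) : ℝ := ∑ i, ∑ x, (f (x + basisVec N i) - f x) ^ 2

lemma energy_eq (f : DTorus d N → ℝ) :
    energy f = (N : ℝ) ^ d * ∑ k, ‖coeff f k‖ ^ 2 * ∑ i, freq (k i) := by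
  have h : ∀ i : Fin d, ∑ x, (f (x + basisVec N i) - f x) ^ 2
      = (N : ℝ) ^ d * ∑ k, ‖coeff f k‖ ^ 2 * freq (k i) := by
    intro i
    rw [← sum_norm_sq_grad_synth]
    refine Finset.sum_congr rfl fun x _ => ?_
    rw [synth_coeff, synth_coeff, ← Complex.ofReal_sub, Complex.norm_real, Real.norm_eq_abs, sq_abs]
  simp only [energy, h, ← Finset.mul_sum]
  rw [Finset.sum_comm]
  simp only [← Finset.mul_sum]

lemma sum_sq_eq (f : DTorus d N → ℝ) :
    ∑ x, f x ^ 2 = (N : ℝ) ^ d * ∑ k, ‖coeff f k‖ ^ 2 := by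
  rw [← sum_norm_sq_synth]
  refine Finset.sum_congr rfl fun x _ => ?_
  rw [synth_coeff, Complex.norm_real, Real.norm_eq_abs, sq_abs]

/-! ### A Nash type inequality -/

lemma card_small_freq {r : ℝ} (hr : 0 ≤ r) :
    ((Finset.univ.filter fun k : ZMod N => (k.valMinAbs.natAbs : ℝ) ≤ r).card : ℝ) ≤ 2 * r + 1 := by
  have h : (Finset.univ.filter fun k : ZMod N => (k.valMinAbs.natAbs : ℝ) ≤ r).card
      ≤ (Finset.Icc (-(⌊r⌋₊ : ℤ)) ⌊r⌋₊).card := by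
    refine Finset.card_le_card_of_injOn ZMod.valMinAbs ?_ ZMod.injective_valMinAbs.injOn
    intro k hk
    rw [Finset.mem_coe, Finset.mem_filter] at hk
    have := Nat.le_floor hk.2
    rw [Finset.mem_coe, Finset.mem_Icc]
    omega
  have h2 : (Finset.Icc (-(⌊r⌋₊ : ℤ)) ⌊r⌋₊).card = 2 * ⌊r⌋₊ + 1 := by
    rw [Int.card_Icc]
    omega
  rw [h2] at h
  calc _ ≤ ((2 * ⌊r⌋₊ + 1 : ℕ) : ℝ) := by exact_mod_cast h
    _ = 2 * (⌊r⌋₊ : ℝ) + 1 := by push_cast; ring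
    _ ≤ 2 * r + 1 := by linarith [Nat.floor_le hr]

open Classical in
lemma card_low_freq {r : ℝ} (hr : 0 ≤ r) :
    ((Finset.univ.filter fun k : DTorus d N => ∀ i, ((k i).valMinAbs.natAbs : ℝ) ≤ r).card : ℝ)
      ≤ (2 * r + 1) ^ d := by
  have h : (Finset.univ.filter fun k : DTorus d N => ∀ i, ((k i).valMinAbs.natAbs : ℝ) ≤ r)
      = Fintype.piFinset fun _ : Fin d =>
        Finset.univ.filter fun k : ZMod N => (k.valMinAbs.natAbs : ℝ) ≤ r := by
    ext k
    simp [Fintype.mem_piFinset]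
  rw [h, Fintype.card_piFinset_const]
  push_cast
  exact pow_le_pow_left₀ (by positivity) (card_small_freq hr) d

/-- Split the frequencies at height sN. Above it the symbol is at least 16s². Below it there are at
most (2sN+1)^d ≤ (3sN)^d modes, each with coefficient at most 2N^{-d} by the ℓ¹ bound. The cut-off s
stays free and is chosen later as a function of time. -/
lemma nash (f : DTorus d N → ℝ) (hf : ∑ x, |f x| ≤ 2) {s : ℝ} (hs : 1 ≤ s * N) :
    16 * s ^ 2 * (∑ x, f x ^ 2 - 4 * (3 * s) ^ d) ≤ energy f := by
  classical
  have hN : (0 : ℝ) < N := by exact_mod_cast NeZero.pos N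
  have hs0 : 0 < s := by
    by_contra h
    nlinarith
  set low := Finset.univ.filter fun k : DTorus d N => ∀ i, ((k i).valMinAbs.natAbs : ℝ) ≤ s * N
    with hlow
  have hcard : (low.card : ℝ) ≤ (3 * s * N) ^ d := by
    refine (card_low_freq (by positivity)).trans (pow_le_pow_left₀ (by positivity) ?_ d)
    linarith
  have hpt : ∀ k, 16 * s ^ 2 * ‖coeff f k‖ ^ 2 ≤ ‖coeff f k‖ ^ 2 * ∑ i, freq (k i)
      + (if k ∈ low then 16 * s ^ 2 * (((N : ℝ) ^ d)⁻¹ * 2) ^ 2 else 0) := by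
    intro k
    have hsum : 0 ≤ ∑ i, freq (k i) := Finset.sum_nonneg fun i _ => freq_nonneg _
    split_ifs with hk
    · have h1 : ‖coeff f k‖ ≤ ((N : ℝ) ^ d)⁻¹ * 2 :=
        (norm_coeff_le f k).trans (by gcongr)
      have h2 := pow_le_pow_left₀ (norm_nonneg _) h1 2
      have h3 : 16 * s ^ 2 * ‖coeff f k‖ ^ 2 ≤ 16 * s ^ 2 * (((N : ℝ) ^ d)⁻¹ * 2) ^ 2 := by gcongr
      have h4 : 0 ≤ ‖coeff f k‖ ^ 2 * ∑ i, freq (k i) := by positivity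
      linarith
    · simp only [hlow, Finset.mem_filter, Finset.mem_univ, true_and, not_forall, not_le] at hk
      obtain ⟨i, hi⟩ := hk
      have h1 : s ≤ ((k i).valMinAbs.natAbs : ℝ) / N := by
        rw [le_div_iff₀ hN]
        exact hi.le
      have h2 : 16 * s ^ 2 ≤ ∑ i, freq (k i) := by
        calc 16 * s ^ 2 ≤ 16 * (((k i).valMinAbs.natAbs : ℝ) / N) ^ 2 := by gcongr
          _ ≤ freq (k i) := sq_le_freq _
          _ ≤ _ := Finset.single_le_sum (f := fun i => freq (k i)) (fun i _ => freq_nonneg _)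
            (Finset.mem_univ i)
      rw [add_zero, mul_comm]
      gcongr
  have hsum := Finset.sum_le_sum fun k (_ : k ∈ Finset.univ) => hpt k
  rw [Finset.sum_add_distrib, ← Finset.mul_sum, Finset.sum_ite_mem, Finset.univ_inter,
    Finset.sum_const, nsmul_eq_mul] at hsum
  rw [energy_eq, sum_sq_eq]
  have hNd : (0 : ℝ) < (N : ℝ) ^ d := by positivity
  have h5 : (low.card : ℝ) * (16 * s ^ 2 * (((N : ℝ) ^ d)⁻¹ * 2) ^ 2)
      ≤ (3 * s * N) ^ d * (16 * s ^ 2 * (((N : ℝ) ^ d)⁻¹ * 2) ^ 2) := by gcongr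
  have h6 : (N : ℝ) ^ d * ((3 * s * N) ^ d * (16 * s ^ 2 * (((N : ℝ) ^ d)⁻¹ * 2) ^ 2))
      = 16 * s ^ 2 * (4 * (3 * s) ^ d) := by
    rw [mul_pow (3 * s)]
    field_simp
    ring
  have h7 := mul_le_mul_of_nonneg_left (hsum.trans (add_le_add_right h5 _)) hNd.le
  rw [mul_add, h6] at h7
  linarith

/-! ### The perturbed spectral gap -/

lemma sum_grad_zero_le (hN : 2 ≤ N) (c : DTorus d N → ℂ) (i : Fin d) :
    ‖synth c (basisVec N i) - synth c 0‖ ^ 2 + ‖synth c (-basisVec N i) - synth c 0‖ ^ 2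
      ≤ (N : ℝ) ^ d * ∑ k, ‖c k‖ ^ 2 * freq (k i) := by
  classical
  rw [← sum_norm_sq_grad_synth]
  have hne : (0 : DTorus d N) ≠ -basisVec N i := by
    intro h
    have : Fact (1 < N) := ⟨by omega⟩
    have := congrFun h i
    simp [basisVec] at this
  have h := Finset.sum_le_sum_of_subset_of_nonneg
    (f := fun x => ‖synth c (x + basisVec N i) - synth c x‖ ^ 2)
    (Finset.subset_univ {0, -basisVec N i}) (fun _ _ _ => sq_nonneg _)
  rw [Finset.sum_pair hne, zero_add, neg_add_cancel, norm_sub_rev (synth c 0)] at h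
  exact h

/-- Cauchy–Schwarz over at most 3^d modes. Compared with the full energy of such modes this gains a
factor N^{-d}, since the gradient is taken at one site only. -/
lemma norm_sq_synth_low_le (c : DTorus d N → ℂ) (hN : 2 ≤ N)
    (hc : ∀ k : DTorus d N, c k ≠ 0 → ∀ j, (k j).valMinAbs.natAbs ≤ 1) (e : DTorus d N) (i : Fin d)
    (he : e = basisVec N i ∨ e = -basisVec N i) :
    ‖synth c e - synth c 0‖ ^ 2 ≤ 3 ^ d * lam N * ∑ k, ‖c k‖ ^ 2 := by
  classical
  set low := Finset.univ.filter fun k : DTorus d N => ∀ i, ((k i).valMinAbs.natAbs : ℝ) ≤ 1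
    with hlow
  have hcard : (low.card : ℝ) ≤ 3 ^ d := by
    have := card_low_freq (d := d) (N := N) (r := 1) (by norm_num)
    norm_num at this
    convert this using 3
    simp [hlow]
  have hz : ∀ k, k ∉ low → c k = 0 := by
    intro k hk
    by_contra h
    refine hk ?_
    rw [hlow, Finset.mem_filter]
    exact ⟨Finset.mem_univ _, fun j => by exact_mod_cast hc k h j⟩
  have h1 : synth c e - synth c 0
      = ∑ k ∈ low, c k * ((ZMod.stdAddChar (k ⬝ᵥ e) : ℂ) - 1) := by
    have := synth_add_sub c 0 e
    rw [zero_add] at this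
    rw [this, synth]
    symm
    refine Finset.sum_subset_zero_on_sdiff (Finset.subset_univ low) ?_ ?_
    · intro k hk
      rw [hz k (Finset.mem_sdiff.mp hk).2]
      simp
    · intro k _
      rw [dotProduct_zero, AddChar.map_zero_eq_one, mul_one]
  have h2 : ∀ k ∈ low, ‖(ZMod.stdAddChar (k ⬝ᵥ e) : ℂ) - 1‖ ^ 2 ≤ lam N := by
    intro k hk
    rw [hlow, Finset.mem_filter] at hk
    have hk1 : (k i).valMinAbs.natAbs ≤ 1 := by exact_mod_cast hk.2 i
    rcases he with rfl | rfl
    · rw [dotProduct_basisVec]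
      exact freq_le_lam hN hk1
    · rw [dotProduct_neg, dotProduct_basisVec]
      refine freq_le_lam hN ?_
      rwa [ZMod.natAbs_valMinAbs_neg]
  rw [h1]
  calc ‖∑ k ∈ low, c k * ((ZMod.stdAddChar (k ⬝ᵥ e) : ℂ) - 1)‖ ^ 2
      ≤ (∑ k ∈ low, ‖c k * ((ZMod.stdAddChar (k ⬝ᵥ e) : ℂ) - 1)‖) ^ 2 := by
        gcongr
        exact norm_sum_le _ _
    _ ≤ low.card * ∑ k ∈ low, ‖c k * ((ZMod.stdAddChar (k ⬝ᵥ e) : ℂ) - 1)‖ ^ 2 :=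
        sq_sum_le_card_mul_sum_sq
    _ ≤ 3 ^ d * ∑ k ∈ low, ‖c k‖ ^ 2 * lam N := by
        gcongr with k hk
        rw [norm_mul, mul_pow]
        gcongr
        exact h2 k hk
    _ ≤ 3 ^ d * ∑ k, ‖c k‖ ^ 2 * lam N := by
        refine mul_le_mul_of_nonneg_left (Finset.sum_le_sum_of_subset_of_nonneg
          (Finset.subset_univ _) fun k _ _ => ?_) (by positivity)
        exact mul_nonneg (sq_nonneg _) (lam_nonneg N)
    _ = _ := by rw [← Finset.sum_mul]; ring

lemma synth_add (c c' : DTorus d N → ℂ) (x : DTorus d N) :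
    synth (fun k => c k + c' k) x = synth c x + synth c' x := by
  simp only [synth, add_mul, Finset.sum_add_distrib]

/-- The weights are tuned for `sum_grad_zero_le_energy`: half of 4/3 is 2/3, which leaves a third of
the high-frequency energy to pay for the gap. -/
lemma norm_add_sq_le (a b : ℂ) : ‖a + b‖ ^ 2 ≤ 4 * ‖a‖ ^ 2 + 4 / 3 * ‖b‖ ^ 2 := by
  have h := pow_le_pow_left₀ (norm_nonneg _) (norm_add_le a b) 2
  nlinarith [sq_nonneg (3 * ‖a‖ - ‖b‖)]

/-- Split f into modes with all |k_j| ≤ 1 and the rest. The low part has small gradients at the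
origin and yields the error term; the high part is absorbed by its own energy. -/
lemma sum_grad_zero_le_energy (hN : 6 ≤ N) (f : DTorus d N → ℝ) (hf : ∑ x, f x = 0) :
    1 / 2 * ∑ i, ((f (basisVec N i) - f 0) ^ 2 + (f (-basisVec N i) - f 0) ^ 2)
      ≤ energy f - (lam N - 160 * d * 3 ^ d / (N : ℝ) ^ (d + 2)) * ∑ x, f x ^ 2 := by
  classical
  have hN0 : (0 : ℝ) < N := by exact_mod_cast NeZero.pos N
  have hNd : (0 : ℝ) < (N : ℝ) ^ d := by positivity
  set c := coeff f with hc
  let p : DTorus d N → Prop := fun k => ∀ j, (k j).valMinAbs.natAbs ≤ 1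
  let a : DTorus d N → ℂ := fun k => if p k then c k else 0
  let b : DTorus d N → ℂ := fun k => if p k then 0 else c k
  have hab : c = fun k => a k + b k := by
    funext k
    by_cases h : p k <;> simp [a, b, h]
  have hsplit : ∀ x, (f x : ℂ) = synth a x + synth b x := by
    intro x
    rw [← synth_add, ← hab, hc, synth_coeff]
  have hgrad : ∀ x, (f x - f 0) ^ 2 ≤ 4 * ‖synth a x - synth a 0‖ ^ 2
      + 4 / 3 * ‖synth b x - synth b 0‖ ^ 2 := by
    intro x
    have h := norm_add_sq_le (synth a x - synth a 0) (synth b x - synth b 0)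
    have h2 : synth a x - synth a 0 + (synth b x - synth b 0) = ((f x - f 0 : ℝ) : ℂ) := by
      push_cast
      rw [hsplit, hsplit]
      ring
    rw [h2, Complex.norm_real, Real.norm_eq_abs, sq_abs] at h
    exact h
  have hlow : ∀ k, a k ≠ 0 → ∀ j, (k j).valMinAbs.natAbs ≤ 1 := by
    intro k hk
    by_contra h
    exact hk (if_neg h)
  have hale : ∑ k, ‖a k‖ ^ 2 ≤ ∑ k, ‖c k‖ ^ 2 := by
    refine Finset.sum_le_sum fun k _ => ?_
    by_cases h : p k <;> simp [a, h]
  set S := ∑ k, ‖c k‖ ^ 2 with hS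
  have hS0 : 0 ≤ S := by positivity
  have hlam := lam_nonneg N
  have hi : ∀ i : Fin d, (f (basisVec N i) - f 0) ^ 2 + (f (-basisVec N i) - f 0) ^ 2 ≤
      8 * (3 ^ d * lam N * S) + 4 / 3 * ((N : ℝ) ^ d * ∑ k, ‖b k‖ ^ 2 * freq (k i)) := by
    intro i
    have h1 := hgrad (basisVec N i)
    have h2 := hgrad (-basisVec N i)
    have h3 := norm_sq_synth_low_le a (by omega) hlow _ i (Or.inl rfl)
    have h4 := norm_sq_synth_low_le a (by omega) hlow _ i (Or.inr rfl)
    have h5 := sum_grad_zero_le (by omega) b i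
    have h6 : 3 ^ d * lam N * ∑ k, ‖a k‖ ^ 2 ≤ 3 ^ d * lam N * S := by gcongr
    linarith
  have hsum : ∑ i, ((f (basisVec N i) - f 0) ^ 2 + (f (-basisVec N i) - f 0) ^ 2) ≤
      d * (8 * (3 ^ d * lam N * S))
        + 4 / 3 * ((N : ℝ) ^ d * ∑ k, ‖b k‖ ^ 2 * ∑ i, freq (k i)) := by
    refine (Finset.sum_le_sum fun i _ => hi i).trans_eq ?_
    rw [Finset.sum_add_distrib, Finset.sum_const, Finset.card_univ, Fintype.card_fin, nsmul_eq_mul,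
      ← Finset.mul_sum, ← Finset.mul_sum, Finset.sum_comm]
    simp only [← Finset.mul_sum]
  -- For a low non-zero mode, symbol ≥ λ suffices, and the zero mode vanishes with the mean. For a
  -- high mode, 2F/3 ≤ F - λ is exactly F ≥ 3λ.
  have hspec : 2 / 3 * ∑ k, ‖b k‖ ^ 2 * ∑ i, freq (k i)
      ≤ ∑ k, ‖c k‖ ^ 2 * (∑ i, freq (k i)) - lam N * S := by
    rw [hS, Finset.mul_sum, Finset.mul_sum, ← Finset.sum_sub_distrib]
    refine Finset.sum_le_sum fun k _ => ?_
    by_cases h : p k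
    · simp only [b, h, if_true, norm_zero]
      by_cases hk : k = 0
      · subst hk
        rw [hc, coeff_zero f hf]
        simp
      · obtain ⟨i, hki⟩ := Function.ne_iff.mp hk
        have h1 : lam N ≤ ∑ i, freq (k i) := (lam_le_freq hki).trans
          (Finset.single_le_sum (f := fun i => freq (k i)) (fun i _ => freq_nonneg _)
            (Finset.mem_univ i))
        nlinarith [sq_nonneg ‖c k‖]
    · simp only [b, h, if_false]
      have h' : ∃ i, ¬ (k i).valMinAbs.natAbs ≤ 1 := not_forall.mp h
      obtain ⟨i, hki⟩ := h'
      have h1 : 3 * lam N ≤ ∑ i, freq (k i) := (three_lam_le_freq hN (by omega)).trans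
        (Finset.single_le_sum (f := fun i => freq (k i)) (fun i _ => freq_nonneg _)
          (Finset.mem_univ i))
      nlinarith [sq_nonneg ‖c k‖]
  have hspec2 := mul_le_mul_of_nonneg_left hspec hNd.le
  -- Here 160 = 4 · 40, with 40 from `lam_le`; the additional N^d in the denominator comes from
  -- Parseval.
  have hlam2 : d * 4 * 3 ^ d * lam N * S ≤ 160 * d * 3 ^ d / (N : ℝ) ^ (d + 2) * ((N : ℝ) ^ d * S) := by
    calc d * 4 * 3 ^ d * lam N * S ≤ d * 4 * 3 ^ d * (40 / (N : ℝ) ^ 2) * S := by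
          gcongr
          exact lam_le N
      _ = _ := by
          rw [pow_add]
          field_simp
          ring
  rw [energy_eq, sum_sq_eq]
  rw [← hc, ← hS]
  linarith

lemma two_mul_sum_grad_zero_le (hN : 2 ≤ N) (f : DTorus d N → ℝ) :
    ∑ i, ((f (basisVec N i) - f 0) ^ 2 + (f (-basisVec N i) - f 0) ^ 2) ≤ energy f := by
  refine Finset.sum_le_sum fun i _ => ?_
  have h := sum_grad_zero_le hN (coeff f) i
  rw [← sum_norm_sq_grad_synth] at h
  simpa only [synth_coeff, ← Complex.ofReal_sub, Complex.norm_real, Real.norm_eq_abs, sq_abs] using h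

/-! ### An upper bound for the spectral gap -/

lemma rwGenerator_apply (hN : 3 ≤ N) (ψ : DTorus d N → ℝ) (x : DTorus d N) :
    rwGenerator d N ψ x
      = 1 / 2 * ∑ i, (ψ (x + basisVec N i) + ψ (x - basisVec N i) - 2 * ψ x) := by
  change (1 / 2) * ∑ y ∈ nbrs d N x, (ψ y - ψ x) = _
  rw [sum_nbrs hN]
  congr 1
  exact Finset.sum_congr rfl fun i _ => by ring

lemma re_stdAddChar_one (hN : 2 ≤ N) : (ZMod.stdAddChar (1 : ZMod N) : ℂ).re = 1 - lam N / 2 := by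
  have : Fact (1 < N) := ⟨by omega⟩
  have h1 : ((1 : ℕ) : ZMod N).valMinAbs = (1 : ℕ) := ZMod.valMinAbs_natCast_of_le_half (by omega)
  rw [Nat.cast_one] at h1
  have h2 : freq (1 : ZMod N) = lam N :=
    le_antisymm (freq_le_lam hN (by rw [h1]; rfl)) (lam_le_freq one_ne_zero)
  have h3 := norm_stdAddChar (1 : ZMod N)
  set z : ℂ := ZMod.stdAddChar (1 : ZMod N)
  have h4 : ‖z‖ ^ 2 = z.re * z.re + z.im * z.im := by
    rw [← Complex.normSq_eq_norm_sq, Complex.normSq_apply]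
  have h5 : freq (1 : ZMod N) = (z.re - 1) * (z.re - 1) + z.im * z.im := by
    rw [freq, ← Complex.normSq_eq_norm_sq, Complex.normSq_apply]
    simp [z]
  rw [h3] at h4
  rw [h2] at h5
  linarith

lemma lam_pos (hN : 2 ≤ N) : 0 < lam N := by
  have hN' : (2 : ℝ) ≤ N := by exact_mod_cast hN
  have : 0 < Real.sin (Real.pi / N) := by
    apply Real.sin_pos_of_pos_of_lt_pi
    · have := Real.pi_pos
      positivity
    · rw [div_lt_iff₀ (by positivity)]
      nlinarith [Real.pi_pos]
  unfold lam
  positivity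

/-- The function cos(2πx_1/N) is an eigenfunction. Only this inequality is needed, since a smaller
gap weakens the final bound. -/
lemma spectralGap_le (hd : 1 ≤ d) (hN : 3 ≤ N) : spectralGap d N ≤ lam N / 2 := by
  let i₀ : Fin d := ⟨0, hd⟩
  let g : DTorus d N → ℝ := fun x => (ZMod.stdAddChar (x i₀) : ℂ).re
  have hg0 : g 0 = 1 := by simp [g]
  have hgen : (-rwGenerator d N) g = (lam N / 2) • g := by
    funext x
    rw [LinearMap.neg_apply, Pi.neg_apply, rwGenerator_apply hN, Finset.sum_eq_single i₀]
    · have h1 := re_stdAddChar_one (N := N) (by omega)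
      have h2 : (ZMod.stdAddChar (-1 : ZMod N) : ℂ)
          = (starRingEnd ℂ) (ZMod.stdAddChar (1 : ZMod N)) := (conj_stdAddChar 1).symm
      simp only [g, Pi.add_apply, Pi.sub_apply, basisVec_same, Pi.smul_apply, smul_eq_mul,
        sub_eq_add_neg (x i₀), AddChar.map_add_eq_mul, h2, Complex.mul_re, Complex.conj_re,
        Complex.conj_im, h1]
      ring
    · intro i _ hi
      simp only [g, Pi.add_apply, Pi.sub_apply, basisVec, Pi.single_eq_of_ne (Ne.symm hi), add_zero,
        sub_zero]
      ring
    · simp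
  have hev : Module.End.HasEigenvalue (-rwGenerator d N) (lam N / 2) := by
    refine Module.End.hasEigenvalue_of_hasEigenvector (x := g)
      (Module.End.hasEigenvector_iff.mpr ⟨Module.End.mem_eigenspace_iff.mpr hgen, ?_⟩)
    intro h
    rw [h] at hg0
    simp at hg0
  refine csInf_le ?_ ⟨?_, hev⟩
  · exact ((Module.End.finite_hasEigenvalue (-rwGenerator d N)).subset fun μ hμ => hμ.2).bddBelow
  · have := lam_pos (N := N) (by omega)
    positivity

/-! ### Decay of the difference process -/

lemma sum_grad_mul_grad (u v : DTorus d N → ℝ) (e : DTorus d N) :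
    ∑ z, v z * (u (z - e) + u (z + e) - 2 * u z)
      = -∑ x, (u (x + e) - u x) * (v (x + e) - v x) := by
  have h1 : ∑ x, u (x + e) * v (x + e) = ∑ x, u x * v x :=
    Equiv.sum_comp (Equiv.addRight e) fun x => u x * v x
  have h2 : ∑ x, u x * v (x + e) = ∑ x, u (x - e) * v x := by
    rw [← Equiv.sum_comp (Equiv.addRight e) fun x => u (x - e) * v x]
    simp
  have e1 : ∀ x, (u (x + e) - u x) * (v (x + e) - v x)
      = u (x + e) * v (x + e) - u (x + e) * v x - u x * v (x + e) + u x * v x := fun x => by ring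
  have e2 : ∀ z, v z * (u (z - e) + u (z + e) - 2 * u z)
      = u (z - e) * v z + u (z + e) * v z - 2 * (u z * v z) := fun x => by ring
  simp only [e1, e2, Finset.sum_add_distrib, Finset.sum_sub_distrib, ← Finset.mul_sum, h1, h2]
  ring

/-- Summation by parts. Evenness of v merges the defect terms at e_i and -e_i; the result is
symmetric in u and v, which is the self-adjointness of `diffGen` on even functions. -/
lemma sum_mul_diffGen (u v : DTorus d N → ℝ) (hv : ∀ z, v (-z) = v z) :
    ∑ z, v z * diffGen u z
      = -∑ i, ∑ x, (u (x + basisVec N i) - u x) * (v (x + basisVec N i) - v x)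
        + ∑ i, (u 0 - u (basisVec N i)) * (v 0 - v (basisVec N i)) := by
  classical
  simp only [diffGen, Finset.mul_sum, smul_eq_mul]
  rw [Finset.sum_comm, ← Finset.sum_neg_distrib, ← Finset.sum_add_distrib]
  refine Finset.sum_congr rfl fun i _ => ?_
  simp only [mul_add (v _)]
  rw [← sum_grad_mul_grad]
  simp only [← mul_add (v _)]
  have h : ∀ z, v z * (u (z - basisVec N i) + u (z + basisVec N i) - 2 * u z
      + 1 / 2 * (2 * (if z = 0 then 1 else 0) - (if z = basisVec N i then 1 else 0)
        - if z = -basisVec N i then 1 else 0) * (u 0 - u (basisVec N i)))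
      = v z * (u (z - basisVec N i) + u (z + basisVec N i) - 2 * u z)
      + 1 / 2 * (u 0 - u (basisVec N i)) * (2 * (if z = 0 then v z else 0)
        - (if z = basisVec N i then v z else 0) - if z = -basisVec N i then v z else 0) := by
    intro z
    have e : ∀ w, (if z = w then v z else 0) = v z * (if z = w then 1 else 0) := fun w => by simp
    simp only [e]
    ring
  have h' := Finset.sum_congr rfl fun z (_ : z ∈ Finset.univ) => h z
  refine h'.trans ?_
  rw [Finset.sum_add_distrib, ← Finset.mul_sum (Finset.univ) _ (1 / 2 * (u 0 - u (basisVec N i)))]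
  congr 1
  simp only [Finset.sum_sub_distrib, ← Finset.mul_sum, Finset.sum_ite_eq', Finset.mem_univ, if_true,
    hv]
  ring

/-- A solution `u` of the heat equation of the difference process, started at the origin. -/
structure IsDiffFlow (u : ℝ → DTorus d N → ℝ) : Prop where
  deriv : ∀ t z, HasDerivAt (fun s => u s z) (diffGen (u t) z) t
  even : ∀ t z, u t (-z) = u t z
  init : ∀ z, z ≠ 0 → u 0 z = 0
  init_zero : u 0 0 = 1
  nonneg : ∀ t, 0 ≤ t → ∀ z, 0 ≤ u t z
  sum_eq : ∀ t, 0 ≤ t → ∑ z, u t z = 1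

/-- The deviation from the uniform distribution. -/
def dev (u : DTorus d N → ℝ) (z : DTorus d N) : ℝ := u z - ((N : ℝ) ^ d)⁻¹

lemma sum_unif : ∑ _z : DTorus d N, ((N : ℝ) ^ d)⁻¹ = 1 := by
  have hN : ((N : ℝ) ^ d) ≠ 0 := pow_ne_zero _ (by exact_mod_cast NeZero.ne N)
  simp [hN]

namespace IsDiffFlow

variable {u : ℝ → DTorus d N → ℝ}

/-- By self-adjointness the pairing of u_s with u_{T-s} does not depend on s; compare s = 0, where
u_0 = δ_0, with s = T/2. -/
lemma apply_zero_eq (h : IsDiffFlow u) (T : ℝ) : u T 0 = ∑ z, u (T / 2) z ^ 2 := by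
  let φ : ℝ → ℝ := fun s => ∑ z, u s z * u (T - s) z
  have hφ : ∀ s, HasDerivAt φ 0 s := by
    intro s
    have h1 : ∀ z, HasDerivAt (fun s => u s z * u (T - s) z)
        (u (T - s) z * diffGen (u s) z - u s z * diffGen (u (T - s)) z) s := by
      intro z
      have h2 : HasDerivAt (fun s => T - s) (-1) s := by
        simpa using (hasDerivAt_id s).const_sub T
      have h3 := (h.deriv (T - s) z).comp s h2
      exact ((h.deriv s z).mul h3).congr_deriv (by simp only [Function.comp]; ring)
    have h4 := HasDerivAt.fun_sum (u := Finset.univ) fun z _ => h1 z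
    refine h4.congr_deriv ?_
    rw [Finset.sum_sub_distrib, sum_mul_diffGen _ _ (h.even _), sum_mul_diffGen _ _ (h.even _)]
    simp only [mul_comm]
    ring
  have h0 := is_const_of_deriv_eq_zero (fun s => (hφ s).differentiableAt) (fun s => (hφ s).deriv)
    0 (T / 2)
  have e1 : φ 0 = u T 0 := by
    simp only [φ]
    rw [Finset.sum_eq_single 0]
    · rw [h.init_zero, one_mul, sub_zero]
    · intro z _ hz
      rw [h.init z hz, zero_mul]
    · simp
  have e2 : φ (T / 2) = ∑ z, u (T / 2) z ^ 2 := by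
    simp only [φ, sub_half, sq]
  rw [← e1, h0, e2]

lemma sum_dev (h : IsDiffFlow u) {t : ℝ} (ht : 0 ≤ t) : ∑ z, dev (u t) z = 0 := by
  simp only [dev, Finset.sum_sub_distrib, h.sum_eq t ht, sum_unif, sub_self]

lemma sum_abs_dev_le (h : IsDiffFlow u) {t : ℝ} (ht : 0 ≤ t) : ∑ z, |dev (u t) z| ≤ 2 := by
  calc ∑ z, |dev (u t) z| ≤ ∑ z, (u t z + ((N : ℝ) ^ d)⁻¹) := by
        refine Finset.sum_le_sum fun z _ => ?_
        refine (abs_sub _ _).trans_eq ?_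
        rw [abs_of_nonneg (h.nonneg t ht z), abs_of_nonneg (by positivity)]
    _ = 2 := by rw [Finset.sum_add_distrib, h.sum_eq t ht, sum_unif]; norm_num

lemma sum_dev_sq_eq (h : IsDiffFlow u) {t : ℝ} (ht : 0 ≤ t) :
    ∑ z, dev (u t) z ^ 2 = ∑ z, u t z ^ 2 - ((N : ℝ) ^ d)⁻¹ := by
  have h1 : ∀ z, dev (u t) z ^ 2
      = u t z ^ 2 - 2 * ((N : ℝ) ^ d)⁻¹ * u t z + ((N : ℝ) ^ d)⁻¹ * ((N : ℝ) ^ d)⁻¹ := by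
    intro z
    unfold dev
    ring
  simp only [h1, Finset.sum_add_distrib, Finset.sum_sub_distrib, ← Finset.mul_sum, h.sum_eq t ht,
    sum_unif]
  ring

lemma sum_dev_sq_le_one (h : IsDiffFlow u) {t : ℝ} (ht : 0 ≤ t) : ∑ z, dev (u t) z ^ 2 ≤ 1 := by
  rw [h.sum_dev_sq_eq ht]
  have h1 : ∑ z, u t z ^ 2 ≤ ∑ z, u t z := by
    refine Finset.sum_le_sum fun z _ => ?_
    have h2 : u t z ≤ 1 := by
      rw [← h.sum_eq t ht]
      exact Finset.single_le_sum (fun z _ => h.nonneg t ht z) (Finset.mem_univ z)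
    nlinarith [h.nonneg t ht z]
  rw [h.sum_eq t ht] at h1
  have : (0 : ℝ) ≤ ((N : ℝ) ^ d)⁻¹ := by positivity
  linarith

lemma apply_zero_eq_dev (h : IsDiffFlow u) {T : ℝ} (hT : 0 ≤ T) :
    (N : ℝ) ^ d * u T 0 - 1 = (N : ℝ) ^ d * ∑ z, dev (u (T / 2)) z ^ 2 := by
  have hN : ((N : ℝ) ^ d) ≠ 0 := pow_ne_zero _ (by exact_mod_cast NeZero.ne N)
  rw [h.sum_dev_sq_eq (by positivity), h.apply_zero_eq, mul_sub, mul_inv_cancel₀ hN]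

lemma hasDerivAt_sum_dev_sq (h : IsDiffFlow u) (t : ℝ) :
    HasDerivAt (fun s => ∑ z, dev (u s) z ^ 2)
      (-2 * energy (dev (u t)) + ∑ i, ((dev (u t) (basisVec N i) - dev (u t) 0) ^ 2
        + (dev (u t) (-basisVec N i) - dev (u t) 0) ^ 2)) t := by
  have h1 : ∀ z, HasDerivAt (fun s => dev (u s) z ^ 2) (2 * (dev (u t) z * diffGen (u t) z)) t := by
    intro z
    exact (((h.deriv t z).sub_const _).pow 2).congr_deriv (by simp [dev]; ring)
  refine (HasDerivAt.fun_sum (u := Finset.univ) fun z _ => h1 z).congr_deriv ?_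
  have heven : ∀ z, dev (u t) (-z) = dev (u t) z := fun z => by rw [dev, h.even, dev]
  rw [← Finset.mul_sum, sum_mul_diffGen _ _ heven, energy, mul_add, mul_neg, neg_mul]
  congr 1
  · congr 2
    refine Finset.sum_congr rfl fun i _ => Finset.sum_congr rfl fun x _ => ?_
    simp only [dev]
    ring
  · rw [Finset.mul_sum]
    refine Finset.sum_congr rfl fun i _ => ?_
    rw [heven]
    simp only [dev]
    ring

lemma exp_decay (hN : 6 ≤ N) (h : IsDiffFlow u) {s₀ s : ℝ} (hs₀ : 0 ≤ s₀) (hs : s₀ ≤ s) {r : ℝ}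
    (hr : r = lam N - 160 * d * 3 ^ d / (N : ℝ) ^ (d + 2)) :
    ∑ z, dev (u s) z ^ 2 ≤ (∑ z, dev (u s₀) z ^ 2) * Real.exp (-2 * r * (s - s₀)) := by
  -- Grönwall's argument: the perturbed gap makes this product nonincreasing.
  let g : ℝ → ℝ := fun s => (∑ z, dev (u s) z ^ 2) * Real.exp (2 * r * s)
  have hg : ∀ s, HasDerivAt g
      ((-2 * energy (dev (u s)) + ∑ i, ((dev (u s) (basisVec N i) - dev (u s) 0) ^ 2
        + (dev (u s) (-basisVec N i) - dev (u s) 0) ^ 2)) * Real.exp (2 * r * s)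
        + (∑ z, dev (u s) z ^ 2) * (Real.exp (2 * r * s) * (2 * r))) s := by
    intro s
    have h2 : HasDerivAt (fun s => 2 * r * s) (2 * r) s := by
      simpa using (hasDerivAt_id s).const_mul (2 * r)
    exact (h.hasDerivAt_sum_dev_sq s).mul h2.exp
  have hanti : AntitoneOn g (Set.Ici 0) := by
    refine antitoneOn_of_deriv_nonpos (convex_Ici 0)
      (fun s _ => (hg s).continuousAt.continuousWithinAt)
      (fun s _ => (hg s).differentiableAt.differentiableWithinAt) ?_
    intro s hs
    rw [interior_Ici, Set.mem_Ioi] at hs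
    rw [(hg s).deriv]
    have h3 := sum_grad_zero_le_energy hN (dev (u s)) (h.sum_dev hs.le)
    rw [← hr] at h3
    have h4 := Real.exp_pos (2 * r * s)
    have h5 : -2 * energy (dev (u s)) + ∑ i, ((dev (u s) (basisVec N i) - dev (u s) 0) ^ 2
        + (dev (u s) (-basisVec N i) - dev (u s) 0) ^ 2) + 2 * r * ∑ z, dev (u s) z ^ 2 ≤ 0 := by
      linarith
    have h6 := mul_nonpos_of_nonpos_of_nonneg h5 h4.le
    linarith
  have hle := hanti (Set.mem_Ici.mpr hs₀) (Set.mem_Ici.mpr (hs₀.trans hs)) hs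
  simp only [g] at hle
  have e1 : Real.exp (-2 * r * (s - s₀)) = Real.exp (2 * r * s₀) * (Real.exp (2 * r * s))⁻¹ := by
    rw [← Real.exp_neg, ← Real.exp_add]
    congr 1
    ring
  rw [e1, ← mul_assoc, ← div_eq_mul_inv, le_div_iff₀ (Real.exp_pos _)]
  exact hle

/-- The defect removes at most half of the dissipation, so y' ≤ -energy, and Nash with cut-off
√(a/t) applies as long as t ≤ aN². -/
lemma poly_decay (hd : 1 ≤ d) (hN : 2 ≤ N) (h : IsDiffFlow u) {a K : ℝ}
    (ha : a = ((d : ℝ) / 2 + 1) / 16) (hK : K = 64 * a * 3 ^ d * a ^ ((d : ℝ) / 2)) {s : ℝ}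
    (hs : 0 ≤ s) (hsN : s ≤ a * (N : ℝ) ^ 2) :
    s ^ ((d : ℝ) / 2) * ∑ z, dev (u s) z ^ 2 ≤ K := by
  have ha0 : 0 < a := by rw [ha]; positivity
  have hd0 : (0 : ℝ) < (d : ℝ) / 2 := by
    have : (1 : ℝ) ≤ d := by exact_mod_cast hd
    positivity
  have hK0 : 0 ≤ K := by rw [hK]; positivity
  rcases hs.eq_or_lt with rfl | hspos
  · rw [Real.zero_rpow hd0.ne', zero_mul]
    exact hK0
  let y : ℝ → ℝ := fun s => ∑ z, dev (u s) z ^ 2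
  -- The derivative of the weight contributes (d/2+1) t^{d/2} y and Nash contributes -16a t^{d/2} y;
  -- `a` is chosen to make these cancel. The remainder is the constant `K`, removed by -Ks.
  let g : ℝ → ℝ := fun s => s ^ ((d : ℝ) / 2 + 1) * y s - K * s
  have hy : ∀ t, HasDerivAt y _ t := h.hasDerivAt_sum_dev_sq
  have hg : ∀ t, 0 < t → HasDerivAt g _ t := fun t ht =>
    ((Real.hasDerivAt_rpow_const (p := (d : ℝ) / 2 + 1) (Or.inl ht.ne')).mul (hy t)).sub
      ((hasDerivAt_id t).const_mul K)
  have hanti : AntitoneOn g (Set.Icc 0 s) := by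
    refine antitoneOn_of_deriv_nonpos (convex_Icc 0 s) ?_ ?_ ?_
    · refine ContinuousOn.sub (ContinuousOn.mul ?_ ?_) (by fun_prop)
      · exact (Real.continuous_rpow_const (by positivity)).continuousOn
      · exact fun t _ => (hy t).continuousAt.continuousWithinAt
    · intro t ht
      rw [interior_Icc] at ht
      exact (hg t ht.1).differentiableAt.differentiableWithinAt
    · intro t ht
      rw [interior_Icc] at ht
      have ht0 : 0 < t := ht.1
      rw [(hg t ht0).deriv]
      have hsq : √(a / t) ^ 2 = a / t := Real.sq_sqrt (by positivity)
      have hlow : 1 ≤ √(a / t) * N := by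
        refine le_of_sq_le_sq ?_ (by positivity)
        rw [mul_pow, hsq, one_pow, div_mul_eq_mul_div, le_div_iff₀ ht0, one_mul]
        exact ht.2.le.trans hsN
      have h1 := nash (dev (u t)) (h.sum_abs_dev_le ht0.le) hlow
      rw [hsq, mul_pow] at h1
      have h2 := two_mul_sum_grad_zero_le hN (dev (u t))
      have h3 : √(a / t) ^ d = a ^ ((d : ℝ) / 2) / t ^ ((d : ℝ) / 2) := by
        rw [← Real.div_rpow ha0.le ht0.le, Real.sqrt_eq_rpow, ← Real.rpow_natCast,
          ← Real.rpow_mul (by positivity)]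
        congr 1
        ring
      rw [h3] at h1
      have hp : t ^ ((d : ℝ) / 2 + 1) = t ^ ((d : ℝ) / 2) * t := by
        rw [Real.rpow_add ht0, Real.rpow_one]
      rw [add_sub_cancel_right, hp, mul_one]
      set D := -2 * energy (dev (u t)) + ∑ i, ((dev (u t) (basisVec N i) - dev (u t) 0) ^ 2
        + (dev (u t) (-basisVec N i) - dev (u t) 0) ^ 2) with hD
      set A := t ^ ((d : ℝ) / 2) with hA
      have hA0 : 0 < A := Real.rpow_pos_of_pos ht0 _
      have h4 : D ≤ -(16 * (a / t) * (y t - 4 * (3 ^ d * (a ^ ((d : ℝ) / 2) / A)))) := by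
        have : D ≤ -energy (dev (u t)) := by linarith
        exact this.trans (neg_le_neg h1)
      have h5 : A * t * D ≤ -(16 * a * A * y t) + K := by
        calc A * t * D
            ≤ A * t * -(16 * (a / t) * (y t - 4 * (3 ^ d * (a ^ ((d : ℝ) / 2) / A)))) := by gcongr
          _ = -(16 * a * A * y t) + K := by
            rw [hK]
            field_simp
            ring
      have h6 : (d : ℝ) / 2 + 1 = 16 * a := by rw [ha]; ring
      rw [h6]
      linarith
  have hle := hanti (Set.left_mem_Icc.mpr hs) (Set.right_mem_Icc.mpr hs) hs
  simp only [g] at hle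
  rw [Real.zero_rpow (by positivity), Real.rpow_add hspos, Real.rpow_one] at hle
  refine le_of_mul_le_mul_right ?_ hspos
  simp only [y] at hle
  linarith

end IsDiffFlow

/-! ### Application to the averaging process and gluing of the two time regimes. -/

lemma IsAveragingProcess.isDiffFlow {Ω : Type*} {mΩ : MeasurableSpace Ω} {P : Measure Ω}
    [IsProbabilityMeasure P] {ℱ : Filtration ℝ≥0 mΩ} {η : ℝ≥0 → Ω → ProbMass d N}
    (h : IsAveragingProcess P ℱ dirac0 η) (hN : 3 ≤ N) : IsDiffFlow (meanCorr d N) where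
  deriv := hasDerivAt_meanCorr hN
  even := meanCorr_neg
  init z hz := by rw [meanCorr_zero_eq, if_neg hz]
  init_zero := by rw [meanCorr_zero_eq, if_pos rfl]
  nonneg _ ht := h.meanCorr_nonneg ht
  sum_eq _ ht := h.sum_meanCorr ht

/-- The combined decay bound for small and large times. -/
lemma IsDiffFlow.max_mul_sum_dev_sq_le (hd : 1 ≤ d) (hN : 6 ≤ N) {u : ℝ → DTorus d N → ℝ}
    (h : IsDiffFlow u) {a K r : ℝ} (ha : a = ((d : ℝ) / 2 + 1) / 16)
    (hK : K = 64 * a * 3 ^ d * a ^ ((d : ℝ) / 2))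
    (hr : r = lam N - 160 * d * 3 ^ d / (N : ℝ) ^ (d + 2)) {t : ℝ} (ht : 0 ≤ t) :
    max (min ((N : ℝ) ^ d) (t ^ ((d : ℝ) / 2))) 1 * ∑ z, dev (u (t / 2)) z ^ 2
      ≤ (1 + 2 ^ ((d : ℝ) / 2) * K + K / a ^ ((d : ℝ) / 2)) * Real.exp (80 * a)
        * Real.exp (-(r * t)) := by
  have ha0 : 0 < a := by rw [ha]; positivity
  have hK0 : 0 ≤ K := by rw [hK]; positivity
  have hN0 : (0 : ℝ) < N := by exact_mod_cast NeZero.pos N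
  have hN1 : (1 : ℝ) ≤ N := by exact_mod_cast NeZero.one_le
  have hrle : r ≤ 40 / (N : ℝ) ^ 2 := by
    refine le_trans ?_ (lam_le N)
    rw [hr]
    have : 0 ≤ 160 * d * 3 ^ d / (N : ℝ) ^ (d + 2) := by positivity
    linarith
  -- Up to time 2aN² the exponential changes by at most e^{80a}, so it can be inserted or shifted at
  -- the price of a constant.
  have hrN : 2 * (a * (N : ℝ) ^ 2) * r ≤ 80 * a := by
    calc 2 * (a * (N : ℝ) ^ 2) * r ≤ 2 * (a * (N : ℝ) ^ 2) * (40 / (N : ℝ) ^ 2) := by gcongr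
      _ = 80 * a := by field_simp; norm_num
  have hK2 : 0 ≤ K / a ^ ((d : ℝ) / 2) := by positivity
  have hK1 : 0 ≤ 2 ^ ((d : ℝ) / 2) * K := by positivity
  set y := ∑ z, dev (u (t / 2)) z ^ 2 with hy
  have hy0 : 0 ≤ y := Finset.sum_nonneg fun _ _ => sq_nonneg _
  rcases le_or_gt (t / 2) (a * (N : ℝ) ^ 2) with hcase | hcase
  · have h1 := h.poly_decay hd (by omega) ha hK (by positivity) hcase
    have h2 := h.sum_dev_sq_le_one (t := t / 2) (by positivity)
    have h3 : t ^ ((d : ℝ) / 2) = 2 ^ ((d : ℝ) / 2) * (t / 2) ^ ((d : ℝ) / 2) := by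
      rw [← Real.mul_rpow (by norm_num) (by positivity)]
      congr 1
      ring
    have h4 : max (min ((N : ℝ) ^ d) (t ^ ((d : ℝ) / 2))) 1 ≤ t ^ ((d : ℝ) / 2) + 1 := by
      have : 0 ≤ t ^ ((d : ℝ) / 2) := by positivity
      refine max_le ((min_le_right _ _).trans (by linarith)) (by linarith)
    have h5 : 1 ≤ Real.exp (80 * a) * Real.exp (-(r * t)) := by
      rw [← Real.exp_add]
      refine Real.one_le_exp ?_
      -- For small N the error term can exceed λ, making r negative.
      rcases le_or_gt r 0 with h0 | h0
      · nlinarith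
      · have : r * t ≤ 2 * (a * (N : ℝ) ^ 2) * r := by nlinarith
        linarith
    calc max (min ((N : ℝ) ^ d) (t ^ ((d : ℝ) / 2))) 1 * y
        ≤ (t ^ ((d : ℝ) / 2) + 1) * y := by gcongr
      _ = 2 ^ ((d : ℝ) / 2) * ((t / 2) ^ ((d : ℝ) / 2) * y) + y := by rw [h3]; ring
      _ ≤ 2 ^ ((d : ℝ) / 2) * K + 1 := by gcongr
      _ ≤ (1 + 2 ^ ((d : ℝ) / 2) * K + K / a ^ ((d : ℝ) / 2)) * 1 := by linarith
      _ ≤ (1 + 2 ^ ((d : ℝ) / 2) * K + K / a ^ ((d : ℝ) / 2))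
          * (Real.exp (80 * a) * Real.exp (-(r * t))) := by gcongr
      _ = _ := by ring
  -- Late times: polynomial decay up to aN² already gives N^d y ≤ K/a^{d/2}, and exponential decay
  -- is started from there.
  · have hs0 : 0 ≤ a * (N : ℝ) ^ 2 := by positivity
    have h1 := h.poly_decay hd (by omega) ha hK hs0 le_rfl
    have h2 := h.exp_decay hN hs0 hcase.le hr
    set y₀ := ∑ z, dev (u (a * (N : ℝ) ^ 2)) z ^ 2
    have h3 : (a * (N : ℝ) ^ 2) ^ ((d : ℝ) / 2) = a ^ ((d : ℝ) / 2) * (N : ℝ) ^ d := by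
      rw [Real.mul_rpow ha0.le (by positivity)]
      congr 1
      rw [← Real.rpow_natCast, ← Real.rpow_natCast, ← Real.rpow_mul hN0.le]
      congr 1
      push_cast
      ring
    have h4 : (N : ℝ) ^ d * y₀ ≤ K / a ^ ((d : ℝ) / 2) := by
      rw [le_div_iff₀ (by positivity)]
      rw [h3] at h1
      linarith
    have h5 : max (min ((N : ℝ) ^ d) (t ^ ((d : ℝ) / 2))) 1 ≤ (N : ℝ) ^ d :=
      max_le (min_le_left _ _) (one_le_pow₀ hN1)
    have h6 : Real.exp (-2 * r * (t / 2 - a * (N : ℝ) ^ 2))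
        ≤ Real.exp (80 * a) * Real.exp (-(r * t)) := by
      rw [← Real.exp_add]
      refine Real.exp_le_exp.mpr ?_
      linarith
    calc max (min ((N : ℝ) ^ d) (t ^ ((d : ℝ) / 2))) 1 * y
        ≤ (N : ℝ) ^ d * (y₀ * Real.exp (-2 * r * (t / 2 - a * (N : ℝ) ^ 2))) := by gcongr
      _ = (N : ℝ) ^ d * y₀ * Real.exp (-2 * r * (t / 2 - a * (N : ℝ) ^ 2)) := by ring
      _ ≤ K / a ^ ((d : ℝ) / 2) * (Real.exp (80 * a) * Real.exp (-(r * t))) := by gcongr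
      _ ≤ (1 + 2 ^ ((d : ℝ) / 2) * K + K / a ^ ((d : ℝ) / 2))
          * (Real.exp (80 * a) * Real.exp (-(r * t))) := by
          gcongr
          linarith
      _ = _ := by ring

end DTorus

end

theorem mainTheorem6 (d : ℕ) (hd : 1 ≤ d) :
    ∃ B C : ℝ, 0 < B ∧ 0 < C ∧ ∃ N₀ : ℕ, ∀ (N : ℕ) [NeZero N], N₀ ≤ N →
      ∀ (Ω : Type*) (mΩ : MeasurableSpace Ω) (P : Measure Ω) (_ : IsProbabilityMeasure P)
        (ℱ : Filtration ℝ≥0 mΩ) (η : ℝ≥0 → Ω → DTorus.ProbMass d N),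
        DTorus.IsAveragingProcess P ℱ DTorus.dirac0 η →
        ∀ t : ℝ≥0,
          ∫ ω, DTorus.l2norm d N (fun x => (η t ω).1 x / DTorus.unif d N x - 1) ^ 2 ∂P
            ≤ C * (N : ℝ) ^ d / max (min ((N : ℝ) ^ d) ((t : ℝ) ^ ((d : ℝ) / 2))) 1
              * Real.exp (-2 * (t : ℝ) / DTorus.tRel d N + B * (t : ℝ) / (N : ℝ) ^ (d + 2)) := by
  obtain ⟨a, ha⟩ : ∃ a : ℝ, a = ((d : ℝ) / 2 + 1) / 16 := ⟨_, rfl⟩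
  obtain ⟨K, hK⟩ : ∃ K : ℝ, K = 64 * a * 3 ^ d * a ^ ((d : ℝ) / 2) := ⟨_, rfl⟩
  have hd0 : (0 : ℝ) < d := by exact_mod_cast hd
  have ha0 : 0 < a := by rw [ha]; positivity
  have hK0 : 0 < K := by rw [hK]; positivity
  refine ⟨160 * d * 3 ^ d,
    (1 + 2 ^ ((d : ℝ) / 2) * K + K / a ^ ((d : ℝ) / 2)) * Real.exp (80 * a),
    by positivity, by positivity, 6, ?_⟩
  intro N _ hN Ω mΩ P _ ℱ η h t
  have ht : (0 : ℝ) ≤ t := NNReal.coe_nonneg t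
  have hflow := h.isDiffFlow (by omega)
  rw [h.integral_l2norm, hflow.apply_zero_eq_dev ht]
  have hmain := hflow.max_mul_sum_dev_sq_le hd hN ha hK rfl ht
  set C := (1 + 2 ^ ((d : ℝ) / 2) * K + K / a ^ ((d : ℝ) / 2)) * Real.exp (80 * a) with hC
  have hexp : Real.exp (-((DTorus.lam N - 160 * d * 3 ^ d / (N : ℝ) ^ (d + 2)) * (t : ℝ)))
      ≤ Real.exp (-2 * (t : ℝ) / DTorus.tRel d N
        + 160 * d * 3 ^ d * (t : ℝ) / (N : ℝ) ^ (d + 2)) := by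
    refine Real.exp_le_exp.mpr ?_
    -- Since the gap is at most λ/2, -2t/t_rel ≥ -λt; the error term of r becomes the term with B.
    have hgap := mul_le_mul_of_nonneg_left (DTorus.spectralGap_le (N := N) hd (by omega)) ht
    have e1 : -2 * (t : ℝ) / DTorus.tRel d N = -2 * (t * DTorus.spectralGap d N) := by
      rw [DTorus.tRel, one_div, div_inv_eq_mul]
      ring
    rw [e1, sub_mul, div_mul_eq_mul_div]
    linarith
  have hM : 0 < max (min ((N : ℝ) ^ d) ((t : ℝ) ^ ((d : ℝ) / 2))) 1 :=
    lt_of_lt_of_le one_pos (le_max_right _ _)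
  rw [div_mul_eq_mul_div, le_div_iff₀ hM]
  have hC0 : 0 ≤ C := by positivity
  calc (N : ℝ) ^ d * (∑ z, DTorus.dev (DTorus.meanCorr d N (t / 2)) z ^ 2)
        * max (min ((N : ℝ) ^ d) ((t : ℝ) ^ ((d : ℝ) / 2))) 1
      = (N : ℝ) ^ d * (max (min ((N : ℝ) ^ d) ((t : ℝ) ^ ((d : ℝ) / 2))) 1
        * ∑ z, DTorus.dev (DTorus.meanCorr d N (t / 2)) z ^ 2) := by ring
    _ ≤ (N : ℝ) ^ d * (C * Real.exp (-((DTorus.lam N - 160 * d * 3 ^ d / (N : ℝ) ^ (d + 2))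
        * (t : ℝ)))) := by gcongr
    _ ≤ (N : ℝ) ^ d * (C * Real.exp (-2 * (t : ℝ) / DTorus.tRel d N
        + 160 * d * 3 ^ d * (t : ℝ) / (N : ℝ) ^ (d + 2))) := by gcongr
    _ = _ := by ring
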